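/- Let $\mathbb K=\mathbb R$ or $\mathbb C$, and let "smooth" mean $C^\infty$ if $\mathbb K=\mathbb R$ and holomorphic if $\mathbb K=\mathbb C$. Let $M$ be a smooth manifold of dimension $2n$ over $\mathbb K$ with a regular bihamiltonian structure $(P,P')$. This means: $P,P':T^*M\to TM$ are smooth tensor fields such that $P$ and $P'-\lambda P$ ($\lambda\in\mathbb K$) are Poisson tensors, i.e. $\{f,g\}=\langle df,P\,dg\rangle$ is antisymmetric and satisfies the Jacobi identity, and likewise for $P'-\lambda P$; $P$ is invertible at every point; and at every point of a dense subset of $M$ the minimal polynomial of $N=P'P^{-1}$ has degree $n$ and pairwise distinct roots. Let $H_1,\dots,H_n$ be an integrable system on $M$, i.e. smooth functions with $\{H_i,H_j\}=0$ for all $i,j$ and $dH_1\wedge\dots\wedge dH_n\neq0$ at every point. Let $\mathcal D_H$ and $\mathcal D'_H$ be the distributions spanned by $P\,dH_1,\dots,P\,dH_n$ and by $P'dH_1,\dots,P'dH_n$ respectively. Darboux–Nijenhuis (DN) coordinates on an open set $U\subset M$ are smooth $\mathbb K$-valued coordinates $(x_1,\dots,x_n,y_1,\dots,y_n)$ on $U$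 with $\{x_i,y_j\}=\delta_{ij}$, $\{x_i,x_j\}=\{y_i,y_j\}=0$ and $N=\sum_i\lambda_i\left(\frac{\partial}{\partial x_i}\otimes dx_i+\frac{\partial}{\partial y_i}\otimes dy_i\right)$ for some functions $\lambda_i$ on $U$. The system is called separable in these coordinates if around every point of $U$ there are smooth relations $\Phi_i(x_i,y_i;H_1,\dots,H_n)=0$, $i=1,\dots,n$, each containing a single pair of coordinates, that are non-trivial in the sense that $\det\left(\frac{\partial\Phi_i}{\partial H_j}\right)\neq0$. (a) For all DN coordinates on an open set $U\subset M$, the following are equivalent: (i) the system is separable in these coordinates; (ii) $\mathcal D'_H\subset\mathcal D_H$ on $U$; (iii) $N\mathcal D_H\subset\mathcal D_H$ on $U$. (b) Suppose in addition that the $H_i$ depend non-trivially on the momenta, i.e. $\det\left(\frac{\partial H_i}{\partial y_j}\right)\neq0$ at every point of $U$. Then (i)–(iii) hold if and only if the Hamilton–Jacobi equations $H_j\left(x,\frac{\partial S}{\partial x}\right)=\alpha_j$, $j=1,\dots,n$, admit around every point $m_0$ of $U$ an additively separated common complete integral, that is, a smooth solution $S(x;\alpha)=\sum_iS_i(x_i;\alpha_1,\dots,\alpha_n)$,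 defined for $(x,\alpha)$ near $(x(m_0),H(m_0))$, such that at $(x(m_0),H(m_0))$ one has $\det\left(\frac{\partial^2S}{\partial x_i\partial\alpha_j}\right)\neq0$ and $\frac{\partial S}{\partial x}=y(m_0)$. (c) For every family of DN coordinate systems whose domains have dense union in $M$, the system is separable in all coordinate systems of the family if and only if $\mathcal D'_H\subset\mathcal D_H$ on $M$, and if and only if $N\mathcal D_H\subset\mathcal D_H$ on $M$. -/

import Mathlib

open scoped Manifold ContDiff Topology

namespace Bihamiltonian

section

variable {𝕜 : Type*} [RCLike 𝕜] {E : Type*} [NormedAddCommGroup E] [NormedSpace 𝕜 E]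
  {M : Type*} [TopologicalSpace M] [ChartedSpace E M] {n : ℕ}

/-- The differential `df_m`, an element of the cotangent space at `m`. -/
noncomputable def differential (f : M → 𝕜) (m : M) : TangentSpace 𝓘(𝕜, E) m →L[𝕜] 𝕜 :=
  mfderiv 𝓘(𝕜, E) 𝓘(𝕜, 𝕜) f m

variable (𝕜 E M) in
/-- A field of linear maps `T*M → TM`. -/
abbrev BivectorField : Type _ :=
  (m : M) → (TangentSpace 𝓘(𝕜, E) m →L[𝕜] 𝕜) →ₗ[𝕜] TangentSpace 𝓘(𝕜, E) m

/-- The bracket `{f, g} = ⟨df, P dg⟩`. -/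
noncomputable def bracket (P : BivectorField 𝕜 E M) (f g : M → 𝕜) (m : M) : 𝕜 :=
  differential f m (P m (differential g m))

/-- `P` is a Poisson tensor: it is antisymmetric, its bracket maps smooth functions on an open set
to smooth functions (that is, `P` is smooth), and the Jacobi identity holds for all smooth functions
defined on open sets. (The Leibniz rule is automatic.) -/
structure IsPoisson (P : BivectorField 𝕜 E M) : Prop where
  antisymm : ∀ (m : M) (a b : TangentSpace 𝓘(𝕜, E) m →L[𝕜] 𝕜), a (P m b) = -b (P m a)
  smooth : ∀ (U : Set M), IsOpen U → ∀ f g : M → 𝕜,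
    ContMDiffOn 𝓘(𝕜, E) 𝓘(𝕜, 𝕜) ∞ f U → ContMDiffOn 𝓘(𝕜, E) 𝓘(𝕜, 𝕜) ∞ g U →
    ContMDiffOn 𝓘(𝕜, E) 𝓘(𝕜, 𝕜) ∞ (bracket P f g) U
  jacobi : ∀ (U : Set M), IsOpen U → ∀ f g h : M → 𝕜,
    ContMDiffOn 𝓘(𝕜, E) 𝓘(𝕜, 𝕜) ∞ f U → ContMDiffOn 𝓘(𝕜, E) 𝓘(𝕜, 𝕜) ∞ g U →
    ContMDiffOn 𝓘(𝕜, E) 𝓘(𝕜, 𝕜) ∞ h U →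
    ∀ m ∈ U, bracket P f (bracket P g h) m + bracket P g (bracket P h f) m
      + bracket P h (bracket P f g) m = 0

variable (𝕜 E M n) in
/-- A regular bihamiltonian structure on the (`2n`-dimensional) manifold `M`: two compatible Poisson
tensors `P`, `P'`, with `P` invertible at every point, such that at every point of a dense set the
minimal polynomial of `N = P' P⁻¹` has degree `n` and pairwise distinct roots. -/
structure RegularBihamiltonian where
  P : BivectorField 𝕜 E M
  P' : BivectorField 𝕜 E M
  poisson : IsPoisson P
  poisson' : IsPoisson P'
  compatible : ∀ l : 𝕜, IsPoisson (fun m => P' m - l • P m)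
  invertible : ∀ m, Function.Bijective (P m)
  regular : Dense {m : M |
    (minpoly 𝕜 (P' m ∘ₗ (LinearEquiv.ofBijective (P m) (invertible m)).symm.toLinearMap)).natDegree
      = n ∧
    (minpoly 𝕜
      (P' m ∘ₗ (LinearEquiv.ofBijective (P m) (invertible m)).symm.toLinearMap)).Separable}

/-- The recursion operator `N = P' P⁻¹`, an endomorphism of each tangent space. -/
noncomputable def RegularBihamiltonian.N (B : RegularBihamiltonian 𝕜 E M n) (m : M) :
    TangentSpace 𝓘(𝕜, E) m →ₗ[𝕜] TangentSpace 𝓘(𝕜, E) m :=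
  B.P' m ∘ₗ (LinearEquiv.ofBijective (B.P m) (B.invertible m)).symm.toLinearMap

/-- `H_1, …, H_n` is an integrable system: smooth functions in involution with respect to `P`, with
`dH_1 ∧ … ∧ dH_n ≠ 0` at every point. -/
structure IsIntegrableSystem (B : RegularBihamiltonian 𝕜 E M n) (H : Fin n → M → 𝕜) : Prop where
  smooth : ∀ i, ContMDiff 𝓘(𝕜, E) 𝓘(𝕜, 𝕜) ∞ (H i)
  involution : ∀ i j m, bracket B.P (H i) (H j) m = 0
  independent : ∀ m, LinearIndependent 𝕜
    (fun i => (differential (H i) m : TangentSpace 𝓘(𝕜, E) m →L[𝕜] 𝕜))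

/-- The distribution `m ↦ span {Q dH_1, …, Q dH_n}`; `D_H` is the case `Q = P`, and `D'_H` is the
case `Q = P'`. -/
noncomputable def distribution (Q : BivectorField 𝕜 E M) (H : Fin n → M → 𝕜) (m : M) :
    Submodule 𝕜 (TangentSpace 𝓘(𝕜, E) m) :=
  Submodule.span 𝕜 (Set.range fun i => Q m (differential (H i) m))

/-- The coordinates `(x_1, …, x_n, y_1, …, y_n)` given by `c` on its open domain `c.source` are
Darboux–Nijenhuis coordinates: they form a smooth chart, they are canonical for `P`, and they
diagonalize `N`, that is, `N = ∑ λ_i (∂/∂x_i ⊗ dx_i + ∂/∂y_i ⊗ dy_i)`, which is written here as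
`dx_i ∘ N = λ_i dx_i` and `dy_i ∘ N = λ_i dy_i`. -/
structure IsDarbouxNijenhuis (B : RegularBihamiltonian 𝕜 E M n)
    (c : OpenPartialHomeomorph M ((Fin n → 𝕜) × (Fin n → 𝕜))) : Prop where
  smooth : ContMDiffOn 𝓘(𝕜, E) 𝓘(𝕜, (Fin n → 𝕜) × (Fin n → 𝕜)) ∞ c c.source
  smooth_symm : ContMDiffOn 𝓘(𝕜, (Fin n → 𝕜) × (Fin n → 𝕜)) 𝓘(𝕜, E) ∞ c.symm c.target
  bracket_xy : ∀ m ∈ c.source, ∀ i j,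
    bracket B.P (fun m => (c m).1 i) (fun m => (c m).2 j) m = if i = j then 1 else 0
  bracket_xx : ∀ m ∈ c.source, ∀ i j,
    bracket B.P (fun m => (c m).1 i) (fun m => (c m).1 j) m = 0
  bracket_yy : ∀ m ∈ c.source, ∀ i j,
    bracket B.P (fun m => (c m).2 i) (fun m => (c m).2 j) m = 0
  diagonal : ∀ m ∈ c.source, ∃ l : Fin n → 𝕜, ∀ i, ∀ v : TangentSpace 𝓘(𝕜, E) m,
    differential (fun m => (c m).1 i) m (B.N m v) = l i * differential (fun m => (c m).1 i) m v ∧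
    differential (fun m => (c m).2 i) m (B.N m v) = l i * differential (fun m => (c m).2 i) m v

/-- The system `H` is separable in the coordinates `(x, y)` given by `c`: around every point of the
domain there are `n` smooth relations `Φ_i(x_i, y_i; H_1, …, H_n) = 0`, each of them containing a
single pair of coordinates, which are non-trivial in the sense that
`det (∂Φ_i/∂H_j) ≠ 0`. -/
def IsSeparable (c : OpenPartialHomeomorph M ((Fin n → 𝕜) × (Fin n → 𝕜))) (H : Fin n → M → 𝕜) :
    Prop :=
  ∀ m₀ ∈ c.source, ∃ Φ : Fin n → 𝕜 × 𝕜 × (Fin n → 𝕜) → 𝕜,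
    (∀ i, ∀ᶠ z in 𝓝 ((c m₀).1 i, (c m₀).2 i, fun k => H k m₀), ContDiffAt 𝕜 ∞ (Φ i) z) ∧
    (∀ i, ∀ᶠ m in 𝓝 m₀, Φ i ((c m).1 i, (c m).2 i, fun k => H k m) = 0) ∧
    (Matrix.of fun i j => fderiv 𝕜 (fun h : Fin n → 𝕜 => Φ i ((c m₀).1 i, (c m₀).2 i, h))
      (fun k => H k m₀) (Pi.single j 1)).det ≠ 0

/-- The gradient `∂S/∂q` of a function `S(q; α)`. -/
noncomputable def qGradient (S : (Fin n → 𝕜) → (Fin n → 𝕜) → 𝕜) (q a : Fin n → 𝕜) : Fin n → 𝕜 :=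
  fun i => fderiv 𝕜 (fun q => S q a) q (Pi.single i 1)

/-- `S(q; α)` is, near the point `m₀` of the domain of the canonical coordinates `c = (q, p)`, a
common complete integral of the Hamilton–Jacobi equations `H_j(q, ∂S/∂q) = α_j`: it is smooth
near the values of `q` and `H` at `m₀`, it solves the equations there, it satisfies
`det (∂²S/∂q_i∂α_j) ≠ 0`, and `p = ∂S/∂q` at `m₀`. -/
structure IsCompleteIntegralAt (c : OpenPartialHomeomorph M ((Fin n → 𝕜) × (Fin n → 𝕜)))
    (H : Fin n → M → 𝕜) (m₀ : M) (S : (Fin n → 𝕜) → (Fin n → 𝕜) → 𝕜) : Prop where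
  smooth : ∀ᶠ z in 𝓝 ((c m₀).1, fun k => H k m₀), ContDiffAt 𝕜 ∞ (fun w => S w.1 w.2) z
  solves : ∀ᶠ z in 𝓝 ((c m₀).1, fun k => H k m₀), (z.1, qGradient S z.1 z.2) ∈ c.target ∧
    ∀ j, H j (c.symm (z.1, qGradient S z.1 z.2)) = z.2 j
  complete : (Matrix.of fun i j => fderiv 𝕜 (fun a => qGradient S (c m₀).1 a i)
    (fun k => H k m₀) (Pi.single j 1)).det ≠ 0
  momentum : qGradient S (c m₀).1 (fun k => H k m₀) = (c m₀).2

/-- The Hamilton–Jacobi equations of `H_1, …, H_n` are separable in the coordinates given by `c`: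
around every point of the domain they admit an additively separated common complete integral
`S(q; α) = ∑ S_i(q_i; α)`. -/
def HamiltonJacobiSeparable (c : OpenPartialHomeomorph M ((Fin n → 𝕜) × (Fin n → 𝕜)))
    (H : Fin n → M → 𝕜) : Prop :=
  ∀ m₀ ∈ c.source, ∃ S : Fin n → 𝕜 → (Fin n → 𝕜) → 𝕜,
    IsCompleteIntegralAt c H m₀ (fun q a => ∑ i, S i (q i) a)

/-- The functions `H_1, …, H_n` depend non-trivially on the momenta `y_1, …, y_n` of the coordinates
`c = (x, y)`: the determinant of `∂H_i/∂y_j` vanishes nowhere on the domain. -/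
def MomentumNondegenerate (c : OpenPartialHomeomorph M ((Fin n → 𝕜) × (Fin n → 𝕜)))
    (H : Fin n → M → 𝕜) : Prop :=
  ∀ m ∈ c.source, (Matrix.of fun i j => fderiv 𝕜 (fun p => H i (c.symm ((c m).1, p)))
    (c m).2 (Pi.single j 1)).det ≠ 0

end

end Bihamiltonian

/-! Everything passes through Benenti's condition: for each `k` the partial bracket `{H_i, H_j}_k =
∂H_i/∂x_k ∂H_j/∂y_k - ∂H_i/∂y_k ∂H_j/∂x_k` vanishes on its own.

In DN coordinates `⟨dH_i, N^r P dH_j⟩ = ∑_k λ_k^r {H_i, H_j}_k`. By a dimension count `D_H` is the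
common kernel of the `dH_i`, so `D'_H ⊂ D_H` means that these sums vanish for `r = 1`, which
Benenti's condition implies. Conversely, `P' = N P` makes the inclusion the `N`-invariance of `D_H`,
hence the sums vanish for all `r`. Where the `λ_k` are distinct, Vandermonde kills each partial
bracket; density of regular points and continuity do the rest (`IsDarbouxNijenhuis.benentiAt`).

Separation relations imply Benenti's condition by differentiation
(`HasSeparationRelationsAt.benentiAt`). For the converse, exchange `x_k` and `y_k` where `∂h/∂y_k =
0`; then `∂h/∂y` is invertible and `h(x, y) = α` can be solved for `y`. Benenti's condition forces
the `k`-th component of the solution to depend on `x_k` and `α` only (`BenentiAt.exists_separated`).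

For Hamilton–Jacobi, non-degeneracy in the momenta makes the exchange unnecessary: primitives of
`y_k = f_k(x_k; α)` in `x_k` add up to a complete integral, and conversely `y_k = ∂S_k/∂x_k` are
separation relations. Part (c) holds because the inclusion is a closed condition. -/

namespace Bihamiltonian

/-! ### Solving `h(x, y) = α` by functions of one coordinate each. -/

section Separation

variable {𝕜 : Type*} [RCLike 𝕜] {n : ℕ}

/-- Benenti's condition at `p`: for every `k`, the partial derivatives `∂h/∂x_k` and `∂h/∂y_k` are
parallel, that is, the components of `h` are in involution with respect to every pair `(x_k, y_k)`
separately. -/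
def BenentiAt (h : (Fin n → 𝕜) × (Fin n → 𝕜) → Fin n → 𝕜) (p : (Fin n → 𝕜) × (Fin n → 𝕜)) : Prop :=
  ∀ k i j, fderiv 𝕜 h p (Pi.single k 1, 0) i * fderiv 𝕜 h p (0, Pi.single k 1) j
    = fderiv 𝕜 h p (0, Pi.single k 1) i * fderiv 𝕜 h p (Pi.single k 1, 0) j

/-- A function on a ball whose derivatives in the directions `x_j`, `j ≠ k`, vanish does not depend
on these variables. -/
theorem eq_of_fderiv_single_eq_zero {F : Type*} [NormedAddCommGroup F] [NormedSpace 𝕜 F]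
    {φ : (Fin n → 𝕜) × F → 𝕜} {x₀ : Fin n → 𝕜} {a₀ : F} {r : ℝ} (k : Fin n)
    (hφ : ∀ q ∈ Metric.ball (x₀, a₀) r, DifferentiableAt 𝕜 φ q)
    (hzero : ∀ q ∈ Metric.ball (x₀, a₀) r, ∀ j ≠ k, fderiv 𝕜 φ q (Pi.single j 1, 0) = 0)
    {q : (Fin n → 𝕜) × F} (hq : q ∈ Metric.ball (x₀, a₀) r) :
    φ q = φ (Function.update x₀ k (q.1 k), q.2) := by
  -- The displacement from `q` to the point where the claim compares `φ`. Its `k`-th entry is zero,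
  -- so `φ` has zero derivative along it.
  set ξ : Fin n → 𝕜 := Function.update x₀ k (q.1 k) - q.1 with hξ
  have hξk : ξ k = 0 := by simp [hξ]
  let line : 𝕜 → (Fin n → 𝕜) × F := fun s => q + s • (ξ, (0 : F))
  have hline : ∀ s, HasDerivAt line (ξ, (0 : F)) s := fun s => by
    have := ((hasDerivAt_id s).smul_const ((ξ, (0 : F)))).const_add q
    rwa [one_smul] at this
  let S : Set 𝕜 := line ⁻¹' Metric.ball (x₀, a₀) r
  have hSo : IsOpen S := Metric.isOpen_ball.preimage
    (continuous_iff_continuousAt.2 fun s => (hline s).continuousAt)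
  -- Convexity of the ball is a real notion, while the line is parametrized by `𝕜`.
  let : NormedSpace ℝ F := NormedSpace.restrictScalars ℝ 𝕜 F
  have : IsScalarTower ℝ 𝕜 F := RestrictScalars.isScalarTower ℝ 𝕜 F
  have hSc : Convex ℝ S := by
    intro s hs t ht a b ha hb hab
    have hmem := convex_ball (x₀, a₀) r hs ht ha hb hab
    have hq' : q = a • q + b • q := by rw [← add_smul, hab, one_smul]
    have hl : line (a • s + b • t) = a • line s + b • line t := by
      simp only [line]
      conv_lhs => rw [hq']
      rw [add_smul, smul_add, smul_add, smul_assoc, smul_assoc]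
      abel
    rw [← hl] at hmem
    exact hmem
  have hdir : ∀ p ∈ Metric.ball (x₀, a₀) r, fderiv 𝕜 φ p (ξ, 0) = 0 := by
    intro p hp
    have : (ξ, (0 : F)) = ∑ j, ξ j • ((Pi.single j 1 : Fin n → 𝕜), (0 : F)) := by
      refine Prod.ext ?_ ?_
      · rw [Prod.fst_sum]
        ext i
        simp [Finset.sum_apply, Pi.single_apply]
      · simp [Prod.snd_sum]
    rw [this, map_sum]
    refine Finset.sum_eq_zero fun j _ => ?_
    rw [map_smul]
    by_cases hj : j = k
    · rw [hj, hξk, zero_smul]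
    · rw [hzero p hp j hj, smul_zero]
  have hd : ∀ s ∈ S, HasDerivAt (fun s => φ (line s)) 0 s := by
    intro s hs
    have := (hφ _ hs).hasFDerivAt.comp_hasDerivAt s (hline s)
    rwa [hdir _ hs] at this
  have h0 : (0 : 𝕜) ∈ S := by
    have e : line 0 = q := by simp only [line, zero_smul, add_zero]
    rw [← e] at hq
    exact hq
  -- The distance is a maximum over coordinates, so moving some of them to the centre does not leave
  -- the ball.
  have h1 : (1 : 𝕜) ∈ S := by
    have e : line 1 = (Function.update x₀ k (q.1 k), q.2) := by
      ext <;> simp [line, hξ]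
    rw [Set.mem_preimage, e]
    simp only [Metric.mem_ball, Prod.dist_eq, max_lt_iff] at hq ⊢
    refine ⟨lt_of_le_of_lt ?_ hq.1, hq.2⟩
    refine (dist_pi_le_iff dist_nonneg).2 fun i => ?_
    by_cases hi : i = k
    · subst hi
      simpa using dist_le_pi_dist q.1 x₀ i
    · simp [Function.update_of_ne hi]
  have := hSo.is_const_of_deriv_eq_zero hSc.isPreconnected
    (fun s hs => (hd s hs).differentiableAt.differentiableWithinAt)
    (fun s hs => (hd s hs).deriv) h0 h1
  simp only [line, zero_smul, add_zero, one_smul] at this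
  rw [this]
  congr 1
  ext <;> simp [hξ]

/-- A nonzero vector spans all vectors parallel to it. -/
theorem exists_eq_smul_of_mul_eq_mul {u v : Fin n → 𝕜} (hv : v ≠ 0)
    (h : ∀ i j, u i * v j = v i * u j) : ∃ c : 𝕜, u = c • v := by
  obtain ⟨i, hi⟩ := Function.ne_iff.1 hv
  simp only [Pi.zero_apply] at hi
  refine ⟨u i / v i, funext fun j => ?_⟩
  have := h i j
  simp only [Pi.smul_apply, smul_eq_mul]
  field_simp
  linear_combination -this

/-- Under Benenti's condition, if `∂h/∂y` is invertible, then the equations `h(x, y) = α` are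
solved by `y_k = f_k(x_k; α)`. -/
theorem BenentiAt.exists_separated {h : (Fin n → 𝕜) × (Fin n → 𝕜) → Fin n → 𝕜}
    {p₀ : (Fin n → 𝕜) × (Fin n → 𝕜)} (hsm : ∀ᶠ p in 𝓝 p₀, ContDiffAt 𝕜 ∞ h p)
    (hB : ∀ᶠ p in 𝓝 p₀, BenentiAt h p)
    (hy : ∀ y, fderiv 𝕜 h p₀ (0, y) = 0 → y = 0) :
    ∃ f : Fin n → 𝕜 × (Fin n → 𝕜) → 𝕜,
      (∀ k, ∀ᶠ z in 𝓝 (p₀.1 k, h p₀), ContDiffAt 𝕜 ∞ (f k) z) ∧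
      (∀ᶠ p in 𝓝 p₀, ∀ k, p.2 k = f k (p.1 k, h p)) ∧
      (∀ᶠ w in 𝓝 (p₀.1, h p₀), h (w.1, fun k => f k (w.1 k, w.2)) = w.2) ∧
      (Matrix.of fun i j => fderiv 𝕜 (fun a => f i (p₀.1 i, a)) (h p₀) (Pi.single j 1)).det ≠ 0 := by
  -- The derivative of `(x, y) ↦ (x, h)` is block triangular, so injectivity of `∂h/∂y` suffices for
  -- the inverse function theorem.
  let G : (Fin n → 𝕜) × (Fin n → 𝕜) → (Fin n → 𝕜) × (Fin n → 𝕜) := fun p => (p.1, h p)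
  have hG : ∀ p, ContDiffAt 𝕜 ∞ h p → ContDiffAt 𝕜 ∞ G p := fun p hp => contDiffAt_fst.prodMk hp
  have hG' : ∀ p, ContDiffAt 𝕜 ∞ h p →
      HasFDerivAt G ((ContinuousLinearMap.fst 𝕜 _ _).prod (fderiv 𝕜 h p)) p := fun p hp =>
    hasFDerivAt_fst.prodMk (hp.differentiableAt (by simp)).hasFDerivAt
  have hsm₀ := hsm.self_of_nhds
  obtain ⟨A, hA⟩ : ∃ A : ((Fin n → 𝕜) × (Fin n → 𝕜)) ≃L[𝕜] ((Fin n → 𝕜) × (Fin n → 𝕜)),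
      (A : _ →L[𝕜] _) = (ContinuousLinearMap.fst 𝕜 _ _).prod (fderiv 𝕜 h p₀) := by
    have hinj : Function.Injective
        ((ContinuousLinearMap.fst 𝕜 _ _).prod (fderiv 𝕜 h p₀)).toLinearMap := by
      rw [← LinearMap.ker_eq_bot, LinearMap.ker_eq_bot']
      rintro ⟨x, y⟩ hxy
      obtain ⟨rfl, h2⟩ : x = 0 ∧ fderiv 𝕜 h p₀ (x, y) = 0 := by simpa using hxy
      rw [hy y h2]
      rfl
    exact ⟨(LinearEquiv.ofInjectiveEndo _ hinj).toContinuousLinearEquiv, by ext <;> rfl⟩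
  have hAd : HasFDerivAt G (A : _ →L[𝕜] _) p₀ := hA ▸ hG' p₀ hsm₀
  let e := (hG p₀ hsm₀).toOpenPartialHomeomorph G hAd (by simp)
  have hes : p₀ ∈ e.source := (hG p₀ hsm₀).mem_toOpenPartialHomeomorph_source hAd (by simp)
  have heG : ∀ p, e p = G p := fun p => rfl
  -- Invertibility is an open condition; it is needed on a whole ball, for smoothness of the inverse
  -- there and for the vanishing of its cross derivatives.
  have hinv : ∀ᶠ p in 𝓝 p₀, ∃ A : ((Fin n → 𝕜) × (Fin n → 𝕜)) ≃L[𝕜] ((Fin n → 𝕜) × (Fin n → 𝕜)),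
      (A : _ →L[𝕜] _) = (ContinuousLinearMap.fst 𝕜 _ _).prod (fderiv 𝕜 h p) := by
    have hc : ContinuousAt (fun p => (ContinuousLinearMap.fst 𝕜 (Fin n → 𝕜) (Fin n → 𝕜)).prod
        (fderiv 𝕜 h p)) p₀ := by
      have : ContinuousAt (fderiv 𝕜 h) p₀ :=
        (hsm₀.fderiv_right (m := 0) (by simp)).continuousAt
      have hp : Continuous fun B : ((Fin n → 𝕜) × (Fin n → 𝕜)) →L[𝕜] (Fin n → 𝕜) =>
          (ContinuousLinearMap.fst 𝕜 (Fin n → 𝕜) (Fin n → 𝕜)).prod B :=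
        (ContinuousLinearMap.prodₗᵢ (𝕜 := 𝕜) (E := (Fin n → 𝕜) × (Fin n → 𝕜)) (F := Fin n → 𝕜)
          (G := Fin n → 𝕜) 𝕜).continuous.comp (Continuous.prodMk_right _)
      exact hp.continuousAt.comp this
    have := hc.eventually (hA ▸ A.nhds)
    exact this
  have hsymm₀ : e.symm (p₀.1, h p₀) = p₀ := e.left_inv hes
  have htarget : (p₀.1, h p₀) ∈ e.target := e.map_source hes
  have hgood : ∀ᶠ q in 𝓝 (p₀.1, h p₀), q ∈ e.target ∧ ContDiffAt 𝕜 ∞ h (e.symm q) ∧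
      BenentiAt h (e.symm q) ∧
      ∃ A : ((Fin n → 𝕜) × (Fin n → 𝕜)) ≃L[𝕜] ((Fin n → 𝕜) × (Fin n → 𝕜)),
        (A : _ →L[𝕜] _) = (ContinuousLinearMap.fst 𝕜 _ _).prod (fderiv 𝕜 h (e.symm q)) := by
    have hc : Filter.Tendsto e.symm (𝓝 (p₀.1, h p₀)) (𝓝 p₀) := by
      have := e.continuousAt_symm htarget
      rwa [ContinuousAt, hsymm₀] at this
    exact Filter.Eventually.and (e.open_target.mem_nhds htarget)
      (hc.eventually (hsm.and (hB.and hinv)))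
  obtain ⟨r, hr, hball⟩ := Metric.eventually_nhds_iff_ball.1 hgood
  have hcenter : ((p₀.1, h p₀) : (Fin n → 𝕜) × (Fin n → 𝕜)) ∈ Metric.ball (p₀.1, h p₀) r :=
    Metric.mem_ball_self hr
  have hGsymm : ∀ q ∈ Metric.ball (p₀.1, h p₀) r, (e.symm q).1 = q.1 ∧ h (e.symm q) = q.2 := by
    intro q hq
    have := e.right_inv (hball q hq).1
    rw [heG] at this
    exact Prod.ext_iff.1 this
  have hsymm_smooth : ∀ q ∈ Metric.ball (p₀.1, h p₀) r, ContDiffAt 𝕜 ∞ e.symm q := by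
    intro q hq
    obtain ⟨h1, h2, -, A', hA'⟩ := hball q hq
    exact e.contDiffAt_symm h1 (f₀' := A') (hA' ▸ hG' _ h2) (hG _ h2)
  have hF : ∀ (k : Fin n), ∀ q ∈ Metric.ball (p₀.1, h p₀) r,
      ContDiffAt 𝕜 ∞ (fun q => (e.symm q).2 k) q := fun k q hq =>
    contDiffAt_pi.1 (contDiffAt_snd.comp q (hsymm_smooth q hq)) k
  -- The key computation. With `y = Y(x, α)` the solution, differentiating `h(x, Y(x, α)) = α` in
  -- `x_j` gives `∂h/∂x_j + ∂h/∂y · ∂Y/∂x_j = 0`. Since `∂h/∂x_j = c ∂h/∂y_j`, injectivity yields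
  -- `∂Y/∂x_j = -c e_j`, whose `k`-th entry is zero.
  have hF' : ∀ (k : Fin n), ∀ q ∈ Metric.ball (p₀.1, h p₀) r, ∀ j ≠ k,
      fderiv 𝕜 (fun q => (e.symm q).2 k) q (Pi.single j 1, 0) = 0 := by
    intro k q hq j hjk
    obtain ⟨h1, h2, h3, A', hA'⟩ := hball q hq
    set D := fderiv 𝕜 h (e.symm q) with hD
    have hs : HasFDerivAt e.symm (fderiv 𝕜 e.symm q) q :=
      ((hsymm_smooth q hq).differentiableAt (by simp)).hasFDerivAt
    set s := fderiv 𝕜 e.symm q with hsdef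
    have hcomp : HasFDerivAt (fun q => G (e.symm q)) (((ContinuousLinearMap.fst 𝕜 _ _).prod D).comp s)
        q := (hG' _ h2).comp q hs
    have hid : (fun q => G (e.symm q)) =ᶠ[𝓝 q] id :=
      Filter.eventuallyEq_of_mem (e.open_target.mem_nhds h1) fun q' hq' => e.right_inv hq'
    have heq := (hcomp.congr_of_eventuallyEq hid.symm).unique (hasFDerivAt_id q)
    have hfd : fderiv 𝕜 (fun q => (e.symm q).2 k) q (Pi.single j 1, 0)
        = (s (Pi.single j 1, 0)).2 k := by
      have : HasFDerivAt (fun q => (e.symm q).2 k)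
          ((ContinuousLinearMap.proj k).comp ((ContinuousLinearMap.snd 𝕜 _ _).comp s)) q :=
        (((ContinuousLinearMap.proj (R := 𝕜) (φ := fun _ : Fin n => 𝕜) k).comp
          (ContinuousLinearMap.snd 𝕜 (Fin n → 𝕜) (Fin n → 𝕜))).hasFDerivAt (x := e.symm q)).comp q hs
      rw [this.fderiv]
      rfl
    rw [hfd]
    have hval := DFunLike.congr_fun heq (Pi.single j 1, 0)
    simp only [ContinuousLinearMap.comp_apply, ContinuousLinearMap.prod_apply,
      ContinuousLinearMap.coe_fst', ContinuousLinearMap.id_apply, Prod.mk.injEq] at hval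
    obtain ⟨hv1, hv2⟩ := hval
    have hinj : ∀ y, D (0, y) = 0 → y = 0 := by
      intro y hy0
      have : A' (0, y) = 0 := by
        have := DFunLike.congr_fun hA' (0, y)
        rw [← ContinuousLinearEquiv.coe_coe, this]
        exact Prod.ext rfl hy0
      exact (Prod.ext_iff.1 (A'.map_eq_zero_iff.1 this)).2
    have hne : D (0, Pi.single j 1) ≠ 0 := fun h0 => by
      have := congrFun (hinj _ h0) j
      simp at this
    obtain ⟨c, hc⟩ := exists_eq_smul_of_mul_eq_mul hne (h3 j)
    have hsplit : s (Pi.single j 1, 0) = (Pi.single j 1, 0) + (0, (s (Pi.single j 1, 0)).2) :=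
      Prod.ext (by simp [hv1]) (by simp)
    rw [hsplit, map_add, hc, ← map_smul, ← map_add] at hv2
    have := congrFun (hinj _ (by simpa using hv2)) k
    simpa [Pi.single_eq_of_ne (Ne.symm hjk)] using this
  have hupd : ∀ k : Fin n, ContDiff 𝕜 ∞ (fun z : 𝕜 × (Fin n → 𝕜) =>
      ((Function.update p₀.1 k z.1, z.2) : (Fin n → 𝕜) × (Fin n → 𝕜))) := fun k =>
    ((contDiff_update _ p₀.1 k).comp contDiff_fst).prodMk contDiff_snd
  -- The irrelevant coordinates `x_j`, `j ≠ k`, are frozen at their values at `p₀`.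
  let f : Fin n → 𝕜 × (Fin n → 𝕜) → 𝕜 := fun k z =>
    (e.symm (Function.update p₀.1 k z.1, z.2)).2 k
  have hf : ∀ q ∈ Metric.ball (p₀.1, h p₀) r, ∀ k, (e.symm q).2 k = f k (q.1 k, q.2) :=
    fun q hq k => eq_of_fderiv_single_eq_zero (φ := fun q => (e.symm q).2 k) k
      (fun q hq => (hF k q hq).differentiableAt (by simp)) (hF' k) hq
  have hfs : ∀ k, ∀ᶠ z in 𝓝 (p₀.1 k, h p₀), ContDiffAt 𝕜 ∞ (f k) z := by
    intro k
    have : ∀ᶠ z in 𝓝 (p₀.1 k, h p₀), ((Function.update p₀.1 k z.1, z.2) :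
        (Fin n → 𝕜) × (Fin n → 𝕜)) ∈ Metric.ball (p₀.1, h p₀) r := by
      refine (hupd k).continuous.continuousAt.eventually (Metric.isOpen_ball.mem_nhds ?_)
      simpa using hr
    filter_upwards [this] with z hz
    exact (hF k _ hz).comp z (hupd k).contDiffAt
  have h2 : ∀ᶠ p in 𝓝 p₀, ∀ k, p.2 k = f k (p.1 k, h p) := by
    have hc : ContinuousAt G p₀ := (hG p₀ hsm₀).continuousAt
    filter_upwards [hc.eventually (Metric.isOpen_ball.mem_nhds hcenter), e.open_source.mem_nhds hes]
      with p hp hps k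
    have := hf _ hp k
    rwa [← heG, e.left_inv hps] at this
  have h3 : ∀ᶠ w in 𝓝 (p₀.1, h p₀), h (w.1, fun k => f k (w.1 k, w.2)) = w.2 := by
    filter_upwards [Metric.isOpen_ball.mem_nhds hcenter] with w hw
    have : ((w.1, fun k => f k (w.1 k, w.2)) : (Fin n → 𝕜) × (Fin n → 𝕜)) = e.symm w :=
      Prod.ext (hGsymm w hw).1.symm (funext fun k => (hf w hw k).symm)
    rw [this, (hGsymm w hw).2]
  refine ⟨f, hfs, h2, h3, ?_⟩
  have hY : ∀ k, HasFDerivAt (fun a => f k (p₀.1 k, a))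
      (fderiv 𝕜 (fun a => f k (p₀.1 k, a)) (h p₀)) (h p₀) := fun k =>
    (((hfs k).self_of_nhds.differentiableAt (by simp)).comp (h p₀)
      ((differentiableAt_const _).prodMk differentiableAt_id)).hasFDerivAt
  have hY' := hasFDerivAt_pi.2 hY
  set M := ContinuousLinearMap.pi fun k => fderiv 𝕜 (fun a => f k (p₀.1 k, a)) (h p₀)
  have hY₀ : (p₀.1, fun k => f k (p₀.1 k, h p₀)) = p₀ :=
    Prod.ext rfl (funext fun k => (h2.self_of_nhds k).symm)
  -- Differentiating `h(x₀, f(x₀; α)) = α` in `α` exhibits `∂h/∂y` as a left inverse of `M = ∂f/∂α`,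
  -- so `M` is injective.
  have hcomp : HasFDerivAt (fun a => h (p₀.1, fun k => f k (p₀.1 k, a)))
      ((fderiv 𝕜 h p₀).comp ((0 : (Fin n → 𝕜) →L[𝕜] (Fin n → 𝕜)).prod M)) (h p₀) := by
    have hd : HasFDerivAt h (fderiv 𝕜 h p₀) (p₀.1, fun k => f k (p₀.1 k, h p₀)) := by
      rw [hY₀]
      exact (hsm₀.differentiableAt (by simp)).hasFDerivAt
    exact hd.comp (h p₀) ((hasFDerivAt_const p₀.1 (h p₀)).prodMk hY')
  have hid : (fun a => h (p₀.1, fun k => f k (p₀.1 k, a))) =ᶠ[𝓝 (h p₀)] id :=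
    ((Continuous.prodMk_right p₀.1).continuousAt.eventually h3)
  have heq := (hcomp.congr_of_eventuallyEq hid.symm).unique (hasFDerivAt_id (h p₀))
  have hmat : (Matrix.of fun i j => fderiv 𝕜 (fun a => f i (p₀.1 i, a)) (h p₀) (Pi.single j 1))
      = LinearMap.toMatrix' M.toLinearMap := by
    ext i j
    simp [LinearMap.toMatrix'_apply, M]
  rw [hmat, LinearMap.det_toMatrix']
  intro hdet
  have hbot := LinearMap.bot_lt_ker_of_det_eq_zero hdet
  obtain ⟨a, ha, hane⟩ := Submodule.exists_mem_ne_zero_of_ne_bot hbot.ne'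
  have hMa : M a = 0 := ha
  have := DFunLike.congr_fun heq a
  refine hane (this.symm.trans ?_)
  change fderiv 𝕜 h p₀ (0, M a) = 0
  rw [hMa, Prod.mk_zero_zero, map_zero]

end Separation

/-! ### Primitives depending smoothly on parameters, over `ℝ` and `ℂ` alike. -/

section ParametricIntegral

universe u
variable {𝕜 : Type u} [RCLike 𝕜]

theorem intervalIntegrable_comp_ofReal {F : Type*} [NormedAddCommGroup F] [NormedSpace ℝ F]
    {g : 𝕜 → F} (hg : ∀ t ∈ Set.Icc (0 : ℝ) 1, ContinuousAt g (t : 𝕜)) :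
    IntervalIntegrable (fun t : ℝ => g (t : 𝕜)) MeasureTheory.volume 0 1 := by
  refine ContinuousOn.intervalIntegrable fun t ht => ?_
  rw [Set.uIcc_of_le zero_le_one] at ht
  exact ((hg t ht).comp RCLike.continuous_ofReal.continuousAt).continuousWithinAt

/-- Differentiation under the integral sign over the real unit interval. -/
theorem hasFDerivAt_integral_unitInterval {E F : Type*} [NormedAddCommGroup E] [NormedSpace 𝕜 E]
    [ProperSpace E] [NormedAddCommGroup F] [NormedSpace 𝕜 F] [NormedSpace ℝ F]
    {W : Set E} (hW : IsOpen W) {g : E × 𝕜 → F}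
    (hg : ∀ w ∈ W, ∀ t ∈ Set.Icc (0 : ℝ) 1, ContDiffAt 𝕜 1 g (w, (t : 𝕜))) {w : E} (hw : w ∈ W) :
    HasFDerivAt (fun w => ∫ t in (0 : ℝ)..1, g (w, (t : 𝕜)))
      (∫ t in (0 : ℝ)..1, (fderiv 𝕜 g (w, (t : 𝕜))).comp (ContinuousLinearMap.inl 𝕜 E 𝕜)) w := by
  obtain ⟨r, hr, hrW⟩ := Metric.nhds_basis_closedBall.mem_iff.1 (hW.mem_nhds hw)
  let G' : E × 𝕜 → E →L[𝕜] F := fun z => (fderiv 𝕜 g z).comp (ContinuousLinearMap.inl 𝕜 E 𝕜)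
  have hG' : ∀ w ∈ W, ∀ t ∈ Set.Icc (0 : ℝ) 1, ContinuousAt G' (w, (t : 𝕜)) := fun w hw t ht =>
    ((hg w hw t ht).fderiv_right (m := 0) (by simp)).continuousAt.clm_comp continuousAt_const
  have hcont : ContinuousOn (fun z : E × ℝ => G' (z.1, (z.2 : 𝕜)))
      (Metric.closedBall w r ×ˢ Set.Icc (0 : ℝ) 1) := by
    rintro ⟨w', t⟩ ⟨h1, h2⟩
    refine ContinuousAt.continuousWithinAt ?_
    exact ContinuousAt.comp (f := fun z : E × ℝ => (z.1, (z.2 : 𝕜))) (x := (w', t))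
      (hG' w' (hrW h1) t h2)
      (continuous_fst.prodMk (RCLike.continuous_ofReal.comp continuous_snd)).continuousAt
  -- Compactness of the closed ball times the interval provides a constant dominating function.
  obtain ⟨C, hC⟩ := ((isCompact_closedBall w r).prod isCompact_Icc).exists_bound_of_continuousOn
    hcont
  have hIoc : ∀ t : ℝ, t ∈ Set.uIoc (0 : ℝ) 1 → t ∈ Set.Icc (0 : ℝ) 1 := fun t ht => by
    rw [Set.uIoc_of_le zero_le_one] at ht
    exact ⟨ht.1.le, ht.2⟩
  have hint : ∀ w ∈ W, IntervalIntegrable (fun t : ℝ => g (w, (t : 𝕜))) MeasureTheory.volume 0 1 :=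
    fun w hw => intervalIntegrable_comp_ofReal (g := fun t => g (w, t)) fun t ht =>
      (hg w hw t ht).continuousAt.comp (Continuous.prodMk_right w).continuousAt
  refine intervalIntegral.hasFDerivAt_integral_of_dominated_of_fderiv_le
    (F := fun w (t : ℝ) => g (w, (t : 𝕜)))
    (F' := fun w (t : ℝ) => G' (w, (t : 𝕜))) (bound := fun _ => C) (Metric.closedBall_mem_nhds w hr) ?_
    (hint w hw) ?_ ?_ intervalIntegrable_const ?_
  · filter_upwards [hW.mem_nhds hw] with w' hw'
    rw [Set.uIoc_of_le zero_le_one]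
    exact (hint w' hw').aestronglyMeasurable
  · rw [Set.uIoc_of_le zero_le_one]
    exact (intervalIntegrable_comp_ofReal (g := fun t => G' (w, t)) fun t ht =>
      (hG' w hw t ht).comp (Continuous.prodMk_right w).continuousAt).aestronglyMeasurable
  · exact Filter.Eventually.of_forall fun t ht w' hw' => hC (w', t) ⟨hw', hIoc t ht⟩
  · refine Filter.Eventually.of_forall fun t ht w' hw' => ?_
    exact ((hg w' (hrW hw') t (hIoc t ht)).differentiableAt (by simp)).hasFDerivAt.comp w'
      (hasFDerivAt_prodMk_left w' (t : 𝕜))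

/-- Integrals over the real unit interval depend smoothly on parameters. -/
theorem contDiffOn_integral_unitInterval {E F : Type u} [NormedAddCommGroup E] [NormedSpace 𝕜 E]
    [ProperSpace E] [NormedAddCommGroup F] [NormedSpace 𝕜 F] [NormedSpace ℝ F]
    {W : Set E} (hW : IsOpen W) {g : E × 𝕜 → F}
    (hg : ∀ w ∈ W, ∀ t ∈ Set.Icc (0 : ℝ) 1, ContDiffAt 𝕜 ∞ g (w, (t : 𝕜))) (m : ℕ) :
    ContDiffOn 𝕜 m (fun w => ∫ t in (0 : ℝ)..1, g (w, (t : 𝕜))) W := by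
  -- The target changes from `F` to `E →L[𝕜] F` at each induction step. Hence the formula is stated
  -- for all targets, and `E` and `F` share a universe.
  have hd : ∀ {F : Type u} [NormedAddCommGroup F] [NormedSpace 𝕜 F] [NormedSpace ℝ F]
      {g : E × 𝕜 → F}, (∀ w ∈ W, ∀ t ∈ Set.Icc (0 : ℝ) 1, ContDiffAt 𝕜 ∞ g (w, (t : 𝕜))) →
      ∀ w ∈ W, HasFDerivAt (fun w => ∫ t in (0 : ℝ)..1, g (w, (t : 𝕜)))
      (∫ t in (0 : ℝ)..1, (fderiv 𝕜 g (w, (t : 𝕜))).comp (ContinuousLinearMap.inl 𝕜 E 𝕜)) w :=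
    fun hg w hw => hasFDerivAt_integral_unitInterval hW
      (fun w hw t ht => (hg w hw t ht).of_le (by simp)) hw
  induction m generalizing F with
  | zero =>
    exact contDiffOn_zero.2 fun w hw => (hd hg w hw).continuousAt.continuousWithinAt
  | succ m ih =>
    push_cast
    rw [contDiffOn_succ_iff_fderiv_of_isOpen hW]
    refine ⟨fun w hw => (hd hg w hw).differentiableAt.differentiableWithinAt, by simp, ?_⟩
    refine (ih (g := fun z => (fderiv 𝕜 g z).comp (ContinuousLinearMap.inl 𝕜 E 𝕜)) ?_).congr
      fun w hw => (hd hg w hw).fderiv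
    intro w hw t ht
    exact ((hg w hw t ht).fderiv_right (m := ∞) (by simp)).clm_comp contDiffAt_const

/-- A smooth function of a scalar variable and of parameters has, locally, a primitive which
depends smoothly on the parameters. -/
theorem exists_primitive {F : Type u} [NormedAddCommGroup F] [NormedSpace 𝕜 F] [ProperSpace F]
    {f : 𝕜 × F → 𝕜} {t₀ : 𝕜} {a₀ : F} (hf : ∀ᶠ z in 𝓝 (t₀, a₀), ContDiffAt 𝕜 ∞ f z) :
    ∃ S : 𝕜 × F → 𝕜, (∀ᶠ z in 𝓝 (t₀, a₀), ContDiffAt 𝕜 ∞ S z) ∧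
      ∀ᶠ z in 𝓝 (t₀, a₀), HasDerivAt (fun t => S (t, z.2)) (f z) z.1 := by
  obtain ⟨r, hr, hball⟩ := Metric.eventually_nhds_iff_ball.1 hf
  let g : (𝕜 × F) × 𝕜 → 𝕜 := fun z => f (t₀ + z.2 * (z.1.1 - t₀), z.1.2)
  have hmem : ∀ w ∈ Metric.ball (t₀, a₀) r, ∀ t ∈ Set.Icc (0 : ℝ) 1,
      ((t₀ + (t : 𝕜) * (w.1 - t₀), w.2) : 𝕜 × F) ∈ Metric.ball (t₀, a₀) r := by
    intro w hw t ht
    simp only [Metric.mem_ball, Prod.dist_eq, max_lt_iff] at hw ⊢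
    refine ⟨lt_of_le_of_lt ?_ hw.1, hw.2⟩
    rw [dist_eq_norm, dist_eq_norm, add_sub_cancel_left, norm_mul, RCLike.norm_ofReal,
      abs_of_nonneg ht.1]
    exact mul_le_of_le_one_left (norm_nonneg _) ht.2
  have hg : ∀ w ∈ Metric.ball (t₀, a₀) r, ∀ t ∈ Set.Icc (0 : ℝ) 1,
      ContDiffAt 𝕜 ∞ g (w, (t : 𝕜)) := fun w hw t ht =>
    ContDiffAt.comp (f := fun z : (𝕜 × F) × 𝕜 => (t₀ + z.2 * (z.1.1 - t₀), z.1.2))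
      (w, (t : 𝕜)) (hball _ (hmem w hw t ht)) (by fun_prop)
  have hI : ContDiffOn 𝕜 ∞ (fun w => ∫ t in (0 : ℝ)..1, g (w, (t : 𝕜))) (Metric.ball (t₀, a₀) r) :=
    contDiffOn_infty.2 fun m => contDiffOn_integral_unitInterval Metric.isOpen_ball hg m
  -- The integral of `f` along the segment from `t₀` to `z.1`, rescaled to the unit interval.
  refine ⟨fun z => (z.1 - t₀) * ∫ t in (0 : ℝ)..1, g (z, (t : 𝕜)), ?_, ?_⟩
  · filter_upwards [Metric.ball_mem_nhds (t₀, a₀) hr] with z hz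
    exact (contDiffAt_fst.sub contDiffAt_const).mul
      (hI.contDiffAt (Metric.isOpen_ball.mem_nhds hz))
  · filter_upwards [Metric.ball_mem_nhds (t₀, a₀) hr] with z hz
    obtain ⟨x, a⟩ := z
    have hfa : ∀ s : 𝕜, ((s, a) : 𝕜 × F) ∈ Metric.ball (t₀, a₀) r →
        HasDerivAt (fun s => f (s, a)) (deriv (fun s => f (s, a)) s) s := fun s hs =>
      (((hball _ hs).differentiableAt (by simp)).comp s
        (differentiableAt_id.prodMk (differentiableAt_const a))).hasDerivAt
    have hW : IsOpen {s : 𝕜 | ((s, a) : 𝕜 × F) ∈ Metric.ball (t₀, a₀) r} :=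
      Metric.isOpen_ball.preimage (Continuous.prodMk_left a)
    have hF := (hasFDerivAt_integral_unitInterval hW (g := fun z : 𝕜 × 𝕜 => g ((z.1, a), z.2))
      (fun s hs t ht => ((hg (s, a) hs t ht).of_le (by simp)).comp (s, (t : 𝕜))
        (f := fun z : 𝕜 × 𝕜 => ((z.1, a), z.2)) (by fun_prop)) hz).hasDerivAt
    set I' := (∫ t in (0 : ℝ)..1, (fderiv 𝕜 (fun z : 𝕜 × 𝕜 => g ((z.1, a), z.2))
      (x, (t : 𝕜))).comp (ContinuousLinearMap.inl 𝕜 𝕜 𝕜)) 1 with hI'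
    have key := ((hasDerivAt_id x).sub_const t₀).mul hF
    convert! key using 1
    have hcg : ∀ t ∈ Set.Icc (0 : ℝ) 1, ContinuousAt (fun s : 𝕜 => g ((x, a), s)) (t : 𝕜) :=
      fun t ht => (hg (x, a) hz t ht).continuousAt.comp (Continuous.prodMk_right _).continuousAt
    have hcf : ∀ t ∈ Set.Icc (0 : ℝ) 1, ContinuousAt (fun s : 𝕜 =>
        (fderiv 𝕜 (fun z : 𝕜 × 𝕜 => g ((z.1, a), z.2)) (x, s)).comp
          (ContinuousLinearMap.inl 𝕜 𝕜 𝕜)) (t : 𝕜) := by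
      intro t ht
      have : ContDiffAt 𝕜 ∞ (fun z : 𝕜 × 𝕜 => g ((z.1, a), z.2)) (x, (t : 𝕜)) :=
        (hg (x, a) hz t ht).comp (x, (t : 𝕜)) (f := fun z : 𝕜 × 𝕜 => ((z.1, a), z.2)) (by fun_prop)
      exact ((this.fderiv_right (m := 0) (by simp)).continuousAt.comp
        (Continuous.prodMk_right x).continuousAt).clm_comp continuousAt_const
    have hval : ∀ t ∈ Set.Icc (0 : ℝ) 1,
        (fderiv 𝕜 (fun z : 𝕜 × 𝕜 => g ((z.1, a), z.2)) (x, (t : 𝕜))).comp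
          (ContinuousLinearMap.inl 𝕜 𝕜 𝕜) 1
        = deriv (fun s => f (s, a)) (t₀ + t * (x - t₀)) * t := by
      intro t ht
      have h1 : ContDiffAt 𝕜 ∞ (fun z : 𝕜 × 𝕜 => g ((z.1, a), z.2)) (x, (t : 𝕜)) :=
        (hg (x, a) hz t ht).comp (x, (t : 𝕜)) (f := fun z : 𝕜 × 𝕜 => ((z.1, a), z.2)) (by fun_prop)
      have h2 := HasFDerivAt.comp (f := fun e : 𝕜 => (e, (t : 𝕜))) x
        (h1.differentiableAt (by simp)).hasFDerivAt (hasFDerivAt_prodMk_left x (t : 𝕜))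
      have h3 : HasDerivAt (fun s : 𝕜 => t₀ + (t : 𝕜) * (s - t₀)) (t : 𝕜) x := by
        simpa using (((hasDerivAt_id x).sub_const t₀).const_mul (t : 𝕜)).const_add t₀
      exact h2.hasDerivAt.unique ((hfa _ (hmem _ hz t ht)).comp x h3)
    have hint1 : IntervalIntegrable (fun t : ℝ => g ((x, a), (t : 𝕜))) MeasureTheory.volume 0 1 :=
      intervalIntegrable_comp_ofReal hcg
    have hint2 := intervalIntegrable_comp_ofReal hcf
    have hI'' : I' = ∫ t in (0 : ℝ)..1, (fderiv 𝕜 (fun z : 𝕜 × 𝕜 => g ((z.1, a), z.2))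
        (x, (t : 𝕜))).comp (ContinuousLinearMap.inl 𝕜 𝕜 𝕜) 1 :=
      ContinuousLinearMap.intervalIntegral_apply hint2 1
    have hint3 : IntervalIntegrable (fun t : ℝ => (fderiv 𝕜 (fun z : 𝕜 × 𝕜 => g ((z.1, a), z.2))
        (x, (t : 𝕜))).comp (ContinuousLinearMap.inl 𝕜 𝕜 𝕜) 1) MeasureTheory.volume 0 1 :=
      intervalIntegrable_comp_ofReal fun t ht => (hcf t ht).clm_apply continuousAt_const
    -- The product rule for the candidate leaves the integral of `g + (x - t₀) ∂g/∂x`. This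
    -- integrand is the total derivative of `t · f(t₀ + t (x - t₀), a)`, so the integral equals
    -- `f(x, a)`.
    have hder : ∀ t ∈ Set.uIcc (0 : ℝ) 1, HasDerivAt
        (fun t : ℝ => (t : 𝕜) * g ((x, a), (t : 𝕜)))
        (g ((x, a), (t : 𝕜)) + (x - t₀) * (fderiv 𝕜 (fun z : 𝕜 × 𝕜 => g ((z.1, a), z.2))
        (x, (t : 𝕜))).comp (ContinuousLinearMap.inl 𝕜 𝕜 𝕜) 1) t := by
      intro t ht
      rw [Set.uIcc_of_le zero_le_one] at ht
      have h3 : HasDerivAt (fun s : 𝕜 => t₀ + s * (x - t₀)) (x - t₀) (t : 𝕜) := by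
        simpa using ((hasDerivAt_id (t : 𝕜)).mul_const (x - t₀)).const_add t₀
      have h4 := (hasDerivAt_id (t : 𝕜)).mul ((hfa _ (hmem _ hz t ht)).comp (t : 𝕜) h3)
      have h5 : HasDerivAt (fun t : ℝ => (t : 𝕜)) 1 t := by
        simpa using (RCLike.ofRealCLM (K := 𝕜)).hasDerivAt (x := t)
      have h6 := h4.scomp t h5
      rw [hval t ht]
      convert! h6 using 1
      simp [g]
      ring
    have hftc := intervalIntegral.integral_eq_sub_of_hasDerivAt hder
      (hint1.add (hint3.const_mul _))
    rw [intervalIntegral.integral_add hint1 (hint3.const_mul _),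
      intervalIntegral.integral_const_mul, ← hI''] at hftc
    simp only [id, one_mul]
    rw [hftc]
    simp [g]

end ParametricIntegral

/-! ### Equivalence of separation relations and Benenti's condition. -/

section Relations

variable {𝕜 : Type*} [RCLike 𝕜] {n : ℕ}

/-- The functions `h_1, …, h_n` of the coordinates `(x, y)` satisfy separation relations
`Φ_i(x_i, y_i; h) = 0` around `p₀`. -/
def HasSeparationRelationsAt (h : (Fin n → 𝕜) × (Fin n → 𝕜) → Fin n → 𝕜)
    (p₀ : (Fin n → 𝕜) × (Fin n → 𝕜)) : Prop :=
  ∃ Φ : Fin n → 𝕜 × 𝕜 × (Fin n → 𝕜) → 𝕜,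
    (∀ i, ∀ᶠ z in 𝓝 (p₀.1 i, p₀.2 i, h p₀), ContDiffAt 𝕜 ∞ (Φ i) z) ∧
    (∀ i, ∀ᶠ p in 𝓝 p₀, Φ i (p.1 i, p.2 i, h p) = 0) ∧
    (Matrix.of fun i j => fderiv 𝕜 (fun a : Fin n → 𝕜 => Φ i (p₀.1 i, p₀.2 i, a))
      (h p₀) (Pi.single j 1)).det ≠ 0

/-- Differentiating the relations along `v` gives `C · dh(v)` in terms of `∂Φ_i/∂x_i` and
`∂Φ_i/∂y_i`. If `v` lies in the `(x_k, y_k)`-plane, only the `k`-th entry survives, so `dh(v)` is a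
multiple of the fixed vector `C⁻¹ e_k`. -/
theorem HasSeparationRelationsAt.benentiAt {h : (Fin n → 𝕜) × (Fin n → 𝕜) → Fin n → 𝕜}
    {p₀ : (Fin n → 𝕜) × (Fin n → 𝕜)} (hs : HasSeparationRelationsAt h p₀)
    (hd : DifferentiableAt 𝕜 h p₀) : BenentiAt h p₀ := by
  obtain ⟨Φ, hΦ, hrel, hdet⟩ := hs
  set C : Matrix (Fin n) (Fin n) 𝕜 := Matrix.of fun i j =>
    fderiv 𝕜 (fun a : Fin n → 𝕜 => Φ i (p₀.1 i, p₀.2 i, a)) (h p₀) (Pi.single j 1) with hC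
  have hΦd : ∀ i, HasFDerivAt (Φ i) (fderiv 𝕜 (Φ i) (p₀.1 i, p₀.2 i, h p₀))
      (p₀.1 i, p₀.2 i, h p₀) := fun i =>
    ((hΦ i).self_of_nhds.differentiableAt (by simp)).hasFDerivAt
  have hCa : ∀ i (a : Fin n → 𝕜),
      fderiv 𝕜 (Φ i) (p₀.1 i, p₀.2 i, h p₀) (0, 0, a) = C.mulVec a i := by
    intro i a
    have h1 : HasFDerivAt (fun a : Fin n → 𝕜 => (p₀.1 i, p₀.2 i, a))
        ((0 : (Fin n → 𝕜) →L[𝕜] 𝕜).prod ((0 : (Fin n → 𝕜) →L[𝕜] 𝕜).prod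
          (ContinuousLinearMap.id 𝕜 (Fin n → 𝕜)))) (h p₀) :=
      (hasFDerivAt_const _ _).prodMk ((hasFDerivAt_const _ _).prodMk (hasFDerivAt_id _))
    have h2 := ((hΦd i).comp (h p₀) h1).fderiv
    have h3 : fderiv 𝕜 (fun a : Fin n → 𝕜 => Φ i (p₀.1 i, p₀.2 i, a)) (h p₀) a
        = fderiv 𝕜 (Φ i) (p₀.1 i, p₀.2 i, h p₀) (0, 0, a) := DFunLike.congr_fun h2 a
    rw [← h3]
    conv_lhs => rw [pi_eq_sum_univ' a, map_sum]
    refine Finset.sum_congr rfl fun j _ => ?_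
    rw [map_smul, smul_eq_mul, mul_comm]
    rfl
  have hlin : ∀ i (v : (Fin n → 𝕜) × (Fin n → 𝕜)), C.mulVec (fderiv 𝕜 h p₀ v) i =
      -fderiv 𝕜 (Φ i) (p₀.1 i, p₀.2 i, h p₀) (v.1 i, v.2 i, 0) := by
    intro i v
    have h1 : HasFDerivAt (fun p : (Fin n → 𝕜) × (Fin n → 𝕜) => (p.1 i, p.2 i, h p))
        (((ContinuousLinearMap.proj i).comp (ContinuousLinearMap.fst 𝕜 _ _)).prod
          (((ContinuousLinearMap.proj i).comp (ContinuousLinearMap.snd 𝕜 _ _)).prod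
            (fderiv 𝕜 h p₀))) p₀ :=
      ((ContinuousLinearMap.proj (R := 𝕜) (φ := fun _ : Fin n => 𝕜) i).comp
        (ContinuousLinearMap.fst 𝕜 (Fin n → 𝕜) (Fin n → 𝕜))).hasFDerivAt.prodMk
        (((ContinuousLinearMap.proj (R := 𝕜) (φ := fun _ : Fin n => 𝕜) i).comp
        (ContinuousLinearMap.snd 𝕜 (Fin n → 𝕜) (Fin n → 𝕜))).hasFDerivAt.prodMk hd.hasFDerivAt)
    have h2 := (hΦd i).comp p₀ h1
    have h3 : (fun p : (Fin n → 𝕜) × (Fin n → 𝕜) => Φ i (p.1 i, p.2 i, h p)) =ᶠ[𝓝 p₀]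
        fun _ => 0 := hrel i
    have h4 := DFunLike.congr_fun
      ((h2.congr_of_eventuallyEq h3.symm).unique (hasFDerivAt_const 0 p₀)) v
    have h5 : fderiv 𝕜 (Φ i) (p₀.1 i, p₀.2 i, h p₀) (v.1 i, v.2 i, fderiv 𝕜 h p₀ v) = 0 := h4
    have h6 : ((v.1 i, v.2 i, fderiv 𝕜 h p₀ v) : 𝕜 × 𝕜 × (Fin n → 𝕜))
        = (v.1 i, v.2 i, 0) + (0, 0, fderiv 𝕜 h p₀ v) := by simp
    rw [h6, map_add, hCa] at h5
    exact eq_neg_of_add_eq_zero_right h5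
  have hsol : ∀ k (v : (Fin n → 𝕜) × (Fin n → 𝕜)), (∀ i ≠ k, v.1 i = 0 ∧ v.2 i = 0) →
      fderiv 𝕜 h p₀ v = -fderiv 𝕜 (Φ k) (p₀.1 k, p₀.2 k, h p₀) (v.1 k, v.2 k, 0) •
        C⁻¹.mulVec (Pi.single k 1) := by
    intro k v hv
    have h1 : C.mulVec (fderiv 𝕜 h p₀ v) =
        -fderiv 𝕜 (Φ k) (p₀.1 k, p₀.2 k, h p₀) (v.1 k, v.2 k, 0) • Pi.single k 1 := by
      ext i
      rw [hlin]
      by_cases hi : i = k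
      · subst hi; simp
      · rw [(hv i hi).1, (hv i hi).2]
        simp [Pi.single_eq_of_ne hi]
        exact map_zero _
    have h2 := congrArg C⁻¹.mulVec h1
    rwa [Matrix.mulVec_mulVec, Matrix.nonsing_inv_mul _ (isUnit_iff_ne_zero.2 hdet),
      Matrix.one_mulVec, Matrix.mulVec_smul] at h2
  intro k i j
  rw [hsol k (Pi.single k 1, 0) fun i hi => by simp [Pi.single_eq_of_ne hi],
    hsol k (0, Pi.single k 1) fun i hi => by simp [Pi.single_eq_of_ne hi]]
  simp only [Pi.smul_apply, smul_eq_mul]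
  ring

/-- The exchange of `x_k` and `y_k` for all `k` outside the set `s`. -/
noncomputable def swapCoordinates (s : Fin n → Prop) [DecidablePred s] :
    ((Fin n → 𝕜) × (Fin n → 𝕜)) →L[𝕜] ((Fin n → 𝕜) × (Fin n → 𝕜)) :=
  LinearMap.toContinuousLinearMap
    { toFun := fun p => (fun k => if s k then p.1 k else p.2 k,
        fun k => if s k then p.2 k else p.1 k)
      map_add' := fun p q => by
        ext k <;> by_cases hk : s k <;> simp [hk]
      map_smul' := fun c p => by
        ext k <;> by_cases hk : s k <;> simp [hk] }

theorem swapCoordinates_apply (s : Fin n → Prop) [DecidablePred s]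
    (p : (Fin n → 𝕜) × (Fin n → 𝕜)) :
    swapCoordinates s p = (fun k => if s k then p.1 k else p.2 k,
        fun k => if s k then p.2 k else p.1 k) := rfl

theorem swapCoordinates_swapCoordinates (s : Fin n → Prop) [DecidablePred s]
    (p : (Fin n → 𝕜) × (Fin n → 𝕜)) :
    swapCoordinates s (swapCoordinates s p) = p := by
  ext k <;> by_cases hk : s k <;> simp [swapCoordinates_apply, hk]

theorem swapCoordinates_single_left (s : Fin n → Prop) [DecidablePred s] (k : Fin n) :
    swapCoordinates s ((Pi.single k 1, 0) : (Fin n → 𝕜) × (Fin n → 𝕜)) =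
      if s k then (Pi.single k 1, 0) else (0, Pi.single k 1) := by
  by_cases hk : s k <;> ext i <;> by_cases hi : i = k <;>
    simp_all [swapCoordinates_apply]

theorem swapCoordinates_single_right (s : Fin n → Prop) [DecidablePred s] (k : Fin n) :
    swapCoordinates s ((0, Pi.single k 1) : (Fin n → 𝕜) × (Fin n → 𝕜)) =
      if s k then (0, Pi.single k 1) else (Pi.single k 1, 0) := by
  by_cases hk : s k <;> ext i <;> by_cases hi : i = k <;>
    simp_all [swapCoordinates_apply]

/-- The exchange only changes the sign of the partial brackets of the exchanged pairs, which does
not affect their vanishing. -/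
theorem BenentiAt.comp_swapCoordinates {h : (Fin n → 𝕜) × (Fin n → 𝕜) → Fin n → 𝕜}
    {p : (Fin n → 𝕜) × (Fin n → 𝕜)} (s : Fin n → Prop) [DecidablePred s]
    (hB : BenentiAt h (swapCoordinates s p)) (hd : DifferentiableAt 𝕜 h (swapCoordinates s p)) :
    BenentiAt (h ∘ swapCoordinates s) p := by
  intro k i j
  have hfd := (hd.hasFDerivAt.comp p (swapCoordinates (𝕜 := 𝕜) s).hasFDerivAt).fderiv
  rw [hfd]
  simp only [ContinuousLinearMap.comp_apply, swapCoordinates_single_left,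
    swapCoordinates_single_right]
  by_cases hk : s k
  · simpa only [hk, if_true] using hB k i j
  · simpa only [hk, if_false] using (hB k i j).symm

/-- A square matrix with independent rows: a family of `n` vectors `w_k` with no nontrivial linear
form vanishing on all of them is linearly independent. -/
theorem eq_zero_of_sum_smul_eq_zero {w : Fin n → Fin n → 𝕜}
    (hw : ∀ c : Fin n → 𝕜, (∀ k, ∑ i, c i * w k i = 0) → c = 0) {y : Fin n → 𝕜}
    (hy : ∑ k, y k • w k = 0) : y = 0 := by
  by_contra hne
  have : ∃ v ≠ 0, Matrix.vecMul v (Matrix.of w) = 0 := ⟨y, hne, by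
    ext i
    have := congrFun hy i
    simpa [Matrix.vecMul, dotProduct] using this⟩
  rw [Matrix.exists_vecMul_eq_zero_iff, ← Matrix.exists_mulVec_eq_zero_iff] at this
  obtain ⟨c, hc, hc0⟩ := this
  refine hc (hw c fun k => ?_)
  have := congrFun hc0 k
  simpa [Matrix.mulVec, dotProduct, mul_comm] using this

theorem map_inr_eq_sum (D : ((Fin n → 𝕜) × (Fin n → 𝕜)) →L[𝕜] (Fin n → 𝕜)) (y : Fin n → 𝕜) :
    D (0, y) = ∑ k, y k • D (0, Pi.single k 1) := by
  have : ((0, y) : (Fin n → 𝕜) × (Fin n → 𝕜)) = ∑ k, y k • (0, Pi.single k 1) := by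
    refine Prod.ext (by simp [Prod.fst_sum]) ?_
    rw [Prod.snd_sum]
    ext i
    simp [Finset.sum_apply, Pi.single_apply]
  rw [this, map_sum]
  simp only [map_smul]

theorem map_inl_eq_sum (D : ((Fin n → 𝕜) × (Fin n → 𝕜)) →L[𝕜] (Fin n → 𝕜)) (y : Fin n → 𝕜) :
    D (y, 0) = ∑ k, y k • D (Pi.single k 1, 0) := by
  have : ((y, 0) : (Fin n → 𝕜) × (Fin n → 𝕜)) = ∑ k, y k • (Pi.single k 1, 0) := by
    refine Prod.ext ?_ (by simp [Prod.snd_sum])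
    rw [Prod.fst_sum]
    ext i
    simp [Finset.sum_apply, Pi.single_apply]
  rw [this, map_sum]
  simp only [map_smul]

/-- Independent functions satisfying Benenti's condition satisfy separation relations. -/
theorem BenentiAt.hasSeparationRelationsAt {h : (Fin n → 𝕜) × (Fin n → 𝕜) → Fin n → 𝕜}
    {p₀ : (Fin n → 𝕜) × (Fin n → 𝕜)} (hsm : ∀ᶠ p in 𝓝 p₀, ContDiffAt 𝕜 ∞ h p)
    (hB : ∀ᶠ p in 𝓝 p₀, BenentiAt h p)
    (hind : ∀ c : Fin n → 𝕜, (∀ v, ∑ i, c i * fderiv 𝕜 h p₀ v i = 0) → c = 0) :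
    HasSeparationRelationsAt h p₀ := by
  classical
  -- Pairs with `∂h/∂y_k = 0` are exchanged, so that `x_k` plays the role of the momentum there.
  let s : Fin n → Prop := fun k => fderiv 𝕜 h p₀ (0, Pi.single k 1) ≠ 0
  let σ : ((Fin n → 𝕜) × (Fin n → 𝕜)) →L[𝕜] ((Fin n → 𝕜) × (Fin n → 𝕜)) := swapCoordinates s
  have hσσ : ∀ p, σ (σ p) = p := swapCoordinates_swapCoordinates s
  have hσt : Filter.Tendsto σ (𝓝 (σ p₀)) (𝓝 p₀) := by
    have := σ.continuous.tendsto (σ p₀)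
    rwa [hσσ] at this
  have hfd : fderiv 𝕜 (h ∘ σ) (σ p₀) = (fderiv 𝕜 h p₀).comp σ := by
    have hd : DifferentiableAt 𝕜 h (σ (σ p₀)) := by
      rw [hσσ]; exact hsm.self_of_nhds.differentiableAt (by simp)
    have := (hd.hasFDerivAt.comp (σ p₀) σ.hasFDerivAt).fderiv
    rwa [hσσ] at this
  -- A linear form vanishing on the chosen derivative of every pair vanishes on the other one too:
  -- that one is parallel to it, or was zero. Independence of the `dh_i` then forces the form to be
  -- zero.
  have hy : ∀ y, fderiv 𝕜 (h ∘ σ) (σ p₀) (0, y) = 0 → y = 0 := by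
    intro y hy
    rw [map_inr_eq_sum] at hy
    refine eq_zero_of_sum_smul_eq_zero (fun c hc => hind c ?_) hy
    have hk : ∀ k, ∑ i, c i * fderiv 𝕜 h p₀ (0, Pi.single k 1) i = 0 ∧
        ∑ i, c i * fderiv 𝕜 h p₀ (Pi.single k 1, 0) i = 0 := by
      intro k
      have hck := hc k
      rw [hfd, ContinuousLinearMap.comp_apply, swapCoordinates_single_right] at hck
      by_cases hs : s k
      · rw [if_pos hs] at hck
        obtain ⟨a, ha⟩ := exists_eq_smul_of_mul_eq_mul hs (hB.self_of_nhds k)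
        refine ⟨hck, ?_⟩
        rw [ha]
        simp only [Pi.smul_apply, smul_eq_mul, mul_left_comm _ a]
        rw [← Finset.mul_sum, hck, mul_zero]
      · rw [if_neg hs] at hck
        refine ⟨?_, hck⟩
        rw [not_not.1 hs]
        simp
    rintro ⟨a, b⟩
    have hab : ((a, b) : (Fin n → 𝕜) × (Fin n → 𝕜)) = (a, 0) + (0, b) := by simp
    rw [hab, map_add, map_inl_eq_sum, map_inr_eq_sum]
    simp only [Pi.add_apply, Finset.sum_apply, Pi.smul_apply, smul_eq_mul, mul_add,
      Finset.sum_add_distrib, Finset.mul_sum]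
    rw [Finset.sum_comm, Finset.sum_comm (f := fun i k => c i * (b k * _))]
    have h1 : ∀ k, ∑ i, c i * (a k * fderiv 𝕜 h p₀ (Pi.single k 1, 0) i) = 0 := fun k => by
      simp only [mul_left_comm _ (a k)]
      rw [← Finset.mul_sum, (hk k).2, mul_zero]
    have h2 : ∀ k, ∑ i, c i * (b k * fderiv 𝕜 h p₀ (0, Pi.single k 1) i) = 0 := fun k => by
      simp only [mul_left_comm _ (b k)]
      rw [← Finset.mul_sum, (hk k).1, mul_zero]
    simp [h1, h2]
  have hsm' : ∀ᶠ p in 𝓝 (σ p₀), ContDiffAt 𝕜 ∞ (h ∘ σ) p :=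
    (hσt.eventually hsm).mono fun p hp => hp.comp p σ.contDiff.contDiffAt
  have hB' : ∀ᶠ p in 𝓝 (σ p₀), BenentiAt (h ∘ σ) p :=
    (hσt.eventually (hB.and hsm)).mono fun p hp =>
      hp.1.comp_swapCoordinates s (hp.2.differentiableAt (by simp))
  obtain ⟨f, hf, hrel, -, hdet⟩ := BenentiAt.exists_separated hsm' hB' hy
  have hh : (h ∘ σ) (σ p₀) = h p₀ := by rw [Function.comp_apply, hσσ]
  rw [hh] at hf hdet
  -- The relations are `y_k = f_k(x_k; α)`, or `x_k = f_k(y_k; α)` for exchanged pairs.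
  refine ⟨fun k z => if s k then z.2.1 - f k (z.1, z.2.2) else z.1 - f k (z.2.1, z.2.2), ?_, ?_, ?_⟩
  · intro k
    by_cases hs : s k
    · simp only [hs, if_true]
      have hc : ContDiff 𝕜 ∞ fun z : 𝕜 × 𝕜 × (Fin n → 𝕜) => (z.1, z.2.2) := by fun_prop
      have : (σ p₀).1 k = p₀.1 k := by simp [σ, swapCoordinates_apply, hs]
      have h1 := hf k
      rw [this] at h1
      filter_upwards [hc.continuous.continuousAt.eventually h1] with z hz
      exact contDiffAt_snd.fst.sub (hz.comp z hc.contDiffAt)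
    · simp only [hs, if_false]
      have hc : ContDiff 𝕜 ∞ fun z : 𝕜 × 𝕜 × (Fin n → 𝕜) => (z.2.1, z.2.2) := by fun_prop
      have : (σ p₀).1 k = p₀.2 k := by simp [σ, swapCoordinates_apply, hs]
      have h1 := hf k
      rw [this] at h1
      filter_upwards [hc.continuous.continuousAt.eventually h1] with z hz
      exact contDiffAt_fst.sub (hz.comp z hc.contDiffAt)
  · intro k
    filter_upwards [σ.continuous.continuousAt.eventually hrel] with p hp
    have := hp k
    rw [Function.comp_apply, hσσ] at this
    by_cases hs : s k <;> simp [σ, swapCoordinates_apply, hs] at this <;> simp [hs, ← this]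
  · have : ∀ k, (fun a => if s k then p₀.2 k - f k (p₀.1 k, a) else p₀.1 k - f k (p₀.2 k, a))
        = fun a => (σ p₀).2 k - f k ((σ p₀).1 k, a) := by
      intro k
      by_cases hs : s k <;> simp [σ, swapCoordinates_apply, hs]
    simp only [this, fderiv_const_sub]
    have hneg : (Matrix.of fun i j => (-fderiv 𝕜 (fun a => f i ((σ p₀).1 i, a)) (h p₀))
        (Pi.single j 1)) = -(Matrix.of fun i j => fderiv 𝕜 (fun a => f i ((σ p₀).1 i, a)) (h p₀)
        (Pi.single j 1)) := rfl
    rw [hneg, Matrix.det_neg]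
    exact mul_ne_zero (pow_ne_zero _ (neg_ne_zero.2 one_ne_zero)) hdet

end Relations

/-! ### Separated complete integrals and separation relations. -/

section HamiltonJacobi

variable {𝕜 : Type*} [RCLike 𝕜] {n : ℕ}

/-- Along the `i`-th axis all other summands are constant. Only the sum is assumed differentiable,
because a complete integral carries no smoothness of the single `S_i`. -/
theorem qGradient_sum_apply {S : Fin n → 𝕜 → (Fin n → 𝕜) → 𝕜} {q a : Fin n → 𝕜}
    (hd : DifferentiableAt 𝕜 (fun q : Fin n → 𝕜 => ∑ i, S i (q i) a) q) (i : Fin n) :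
    qGradient (fun q a => ∑ i, S i (q i) a) q a i = deriv (fun t => S i t a) (q i) := by
  have h1 : HasDerivAt (fun t : 𝕜 => Function.update q i t) (Pi.single i 1) (q i) :=
    hasDerivAt_update q i (q i)
  have hd' : HasFDerivAt (fun q : Fin n → 𝕜 => ∑ i, S i (q i) a)
      (fderiv 𝕜 (fun q : Fin n → 𝕜 => ∑ i, S i (q i) a) q) (Function.update q i (q i)) := by
    rw [Function.update_eq_self]
    exact hd.hasFDerivAt
  have h2 := (hd'.comp_hasDerivAt (q i) h1).deriv
  rw [qGradient, ← h2]
  have h3 : ((fun q : Fin n → 𝕜 => ∑ i, S i (q i) a) ∘ fun t : 𝕜 => Function.update q i t)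
      = fun t => S i t a + ∑ k ∈ Finset.univ.erase i, S k (q k) a := by
    ext t
    rw [Function.comp_apply, ← Finset.add_sum_erase _ _ (Finset.mem_univ i),
      Function.update_self]
    congr 1
    refine Finset.sum_congr rfl fun k hk => ?_
    rw [Function.update_of_ne (Finset.ne_of_mem_erase hk)]
  rw [h3, deriv_add_const]

theorem qGradient_sum_eq {S : Fin n → 𝕜 → (Fin n → 𝕜) → 𝕜} {q a d : Fin n → 𝕜}
    (hd : ∀ i, HasDerivAt (fun t => S i t a) (d i) (q i)) :
    qGradient (fun q a => ∑ i, S i (q i) a) q a = d := by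
  have : DifferentiableAt 𝕜 (fun q : Fin n → 𝕜 => ∑ i, S i (q i) a) q :=
    DifferentiableAt.fun_sum fun i _ => (hd i).differentiableAt.comp (f := fun q : Fin n → 𝕜 => q i) q
      (differentiableAt_apply i q)
  ext i
  rw [qGradient_sum_apply this, (hd i).deriv]

variable {M : Type*} [TopologicalSpace M]

/-- Integrating the separation relations `y_k = f_k(x_k; α)` yields an additively separated
complete integral. -/
theorem BenentiAt.exists_isCompleteIntegralAt
    {c : OpenPartialHomeomorph M ((Fin n → 𝕜) × (Fin n → 𝕜))} {H : Fin n → M → 𝕜} {m₀ : M}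
    (hm₀ : m₀ ∈ c.source)
    (hsm : ∀ᶠ p in 𝓝 (c m₀), ContDiffAt 𝕜 ∞ (fun p k => H k (c.symm p)) p)
    (hB : ∀ᶠ p in 𝓝 (c m₀), BenentiAt (fun p k => H k (c.symm p)) p)
    (hy : ∀ y, fderiv 𝕜 (fun p k => H k (c.symm p)) (c m₀) (0, y) = 0 → y = 0) :
    ∃ S : Fin n → 𝕜 → (Fin n → 𝕜) → 𝕜,
      IsCompleteIntegralAt c H m₀ (fun q a => ∑ i, S i (q i) a) := by
  obtain ⟨f, hf, hrel, hsol, hdet⟩ := BenentiAt.exists_separated hsm hB hy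
  simp only [c.left_inv hm₀] at hf hsol hdet
  have hrel₀ : ∀ k, (c m₀).2 k = f k ((c m₀).1 k, fun k => H k m₀) := by
    have := hrel.self_of_nhds
    simpa only [c.left_inv hm₀] using this
  choose S hS hS' using fun k => exists_primitive (hf k)
  have hproj : ∀ k, Continuous fun z : (Fin n → 𝕜) × (Fin n → 𝕜) => (z.1 k, z.2) := fun k => by
    fun_prop
  have hev : ∀ {p : Fin n → 𝕜 × (Fin n → 𝕜) → Prop},
      (∀ k, ∀ᶠ z in 𝓝 ((c m₀).1 k, fun k => H k m₀), p k z) →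
      ∀ᶠ z : (Fin n → 𝕜) × (Fin n → 𝕜) in 𝓝 ((c m₀).1, fun k => H k m₀),
        ∀ k, p k (z.1 k, z.2) := fun h =>
    Filter.eventually_all.2 fun k => (hproj k).continuousAt.eventually (h k)
  have hgrad : ∀ᶠ z in 𝓝 ((c m₀).1, fun k => H k m₀),
      qGradient (fun q a => ∑ i, S i (q i, a)) z.1 z.2 = fun k => f k (z.1 k, z.2) :=
    (hev hS').mono fun z hz => qGradient_sum_eq (S := fun i t a => S i (t, a)) hz
  have hp₀ : ((c m₀).1, fun k => f k ((c m₀).1 k, fun k => H k m₀)) = c m₀ :=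
    Prod.ext rfl (funext fun k => (hrel₀ k).symm)
  refine ⟨fun k t a => S k (t, a), ?_, ?_, ?_, ?_⟩
  · filter_upwards [hev hS] with z hz
    exact ContDiffAt.sum fun k _ => (hz k).comp (f := fun z : (Fin n → 𝕜) × (Fin n → 𝕜) =>
      (z.1 k, z.2)) z (by fun_prop)
  · have htarget : ∀ᶠ z in 𝓝 ((c m₀).1, fun k => H k m₀),
        (z.1, fun k => f k (z.1 k, z.2)) ∈ c.target := by
      have hcont : ContinuousAt (fun z : (Fin n → 𝕜) × (Fin n → 𝕜) =>
          (z.1, fun k => f k (z.1 k, z.2))) ((c m₀).1, fun k => H k m₀) :=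
        continuousAt_fst.prodMk (continuousAt_pi.2 fun k =>
          ContinuousAt.comp (f := fun z : (Fin n → 𝕜) × (Fin n → 𝕜) => (z.1 k, z.2))
            (hf k).self_of_nhds.continuousAt (hproj k).continuousAt)
      refine hcont.eventually (c.open_target.mem_nhds ?_)
      change ((c m₀).1, fun k => f k ((c m₀).1 k, fun k => H k m₀)) ∈ c.target
      rw [hp₀]
      exact c.map_source hm₀
    filter_upwards [hgrad, htarget, hsol] with z hz1 hz2 hz3
    rw [hz1]
    exact ⟨hz2, fun j => congrFun hz3 j⟩
  · have : ∀ i, fderiv 𝕜 (fun a => qGradient (fun q a => ∑ i, S i (q i, a)) (c m₀).1 a i)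
        (fun k => H k m₀) = fderiv 𝕜 (fun a => f i ((c m₀).1 i, a)) (fun k => H k m₀) := fun i =>
      Filter.EventuallyEq.fderiv_eq <|
        ((Continuous.prodMk_right (c m₀).1).continuousAt.eventually hgrad).mono fun a ha =>
          congrFun ha i
    simp only [this]
    exact hdet
  · rw [hgrad.self_of_nhds]
    exact (Prod.ext_iff.1 hp₀).2

/-- The gradient of an additively separated complete integral gives separation relations. -/
theorem IsCompleteIntegralAt.hasSeparationRelationsAt
    {c : OpenPartialHomeomorph M ((Fin n → 𝕜) × (Fin n → 𝕜))} {H : Fin n → M → 𝕜} {m₀ : M}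
    (hm₀ : m₀ ∈ c.source) {S : Fin n → 𝕜 → (Fin n → 𝕜) → 𝕜}
    (hS : IsCompleteIntegralAt c H m₀ (fun q a => ∑ i, S i (q i) a))
    (hc : ContinuousAt (fun p k => H k (c.symm p)) (c m₀)) :
    HasSeparationRelationsAt (fun p k => H k (c.symm p)) (c m₀) := by
  obtain ⟨hsm, hsol, hdet, hmom⟩ := hS
  set x₀ := (c m₀).1 with hx₀
  set a₀ : Fin n → 𝕜 := fun k => H k m₀ with ha₀
  set T : (Fin n → 𝕜) → (Fin n → 𝕜) → 𝕜 := fun q a => ∑ i, S i (q i) a with hT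
  have hh₀ : (fun k => H k (c.symm (c m₀))) = a₀ := by rw [c.left_inv hm₀]
  have hTd : ∀ z : (Fin n → 𝕜) × (Fin n → 𝕜), ContDiffAt 𝕜 ∞ (fun w => T w.1 w.2) z →
      DifferentiableAt 𝕜 (fun q => T q z.2) z.1 ∧ ∀ i, qGradient T z.1 z.2 i
        = fderiv 𝕜 (fun w : (Fin n → 𝕜) × (Fin n → 𝕜) => T w.1 w.2) z (Pi.single i 1, 0) := by
    intro z hz
    have := HasFDerivAt.comp (f := fun q : Fin n → 𝕜 => (q, z.2)) z.1
      (hz.differentiableAt (by simp)).hasFDerivAt (hasFDerivAt_prodMk_left z.1 z.2)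
    refine ⟨this.differentiableAt, fun i => ?_⟩
    have h2 : fderiv 𝕜 (fun q => T q z.2) z.1 = _ := this.fderiv
    rw [qGradient, h2]
    rfl
  have hderiv : ∀ᶠ z in 𝓝 (x₀, a₀), ∀ i,
      qGradient T z.1 z.2 i = deriv (fun t => S i t z.2) (z.1 i) :=
    hsm.mono fun z hz i => qGradient_sum_apply (hTd z hz).1 i
  have hgsm : ∀ᶠ z in 𝓝 (x₀, a₀),
      ContDiffAt 𝕜 ∞ (fun z : (Fin n → 𝕜) × (Fin n → 𝕜) => qGradient T z.1 z.2) z := by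
    filter_upwards [hsm.eventually_nhds] with z hz
    refine contDiffAt_pi.2 fun i => ?_
    have h1 : ContDiffAt 𝕜 ∞ (fun z => fderiv 𝕜 (fun w : (Fin n → 𝕜) × (Fin n → 𝕜) => T w.1 w.2) z
        (Pi.single i 1, 0)) z :=
      (hz.self_of_nhds.fderiv_right (m := ∞) (by simp)).clm_apply contDiffAt_const
    exact h1.congr_of_eventuallyEq (hz.mono fun w hw => (hTd w hw).2 i)
  -- the map `(q, α) ↦ (q, ∂S/∂q)` and its local inverse
  let G : (Fin n → 𝕜) × (Fin n → 𝕜) → (Fin n → 𝕜) × (Fin n → 𝕜) := fun z =>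
    (z.1, qGradient T z.1 z.2)
  have hG₀ : G (x₀, a₀) = c m₀ := Prod.ext rfl hmom
  have hGs : ContDiffAt 𝕜 ∞ G (x₀, a₀) := contDiffAt_fst.prodMk hgsm.self_of_nhds
  set B := fderiv 𝕜 (fun z : (Fin n → 𝕜) × (Fin n → 𝕜) => qGradient T z.1 z.2) (x₀, a₀) with hB
  have hg' := (hgsm.self_of_nhds.differentiableAt (by simp)).hasFDerivAt
  have hGd : HasFDerivAt G ((ContinuousLinearMap.fst 𝕜 _ _).prod B) (x₀, a₀) :=
    hasFDerivAt_fst.prodMk hg'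
  have hBa : ∀ i (a : Fin n → 𝕜), B (0, a) i = fderiv 𝕜 (fun a => qGradient T x₀ a i) a₀ a := by
    intro i a
    have h1 := HasFDerivAt.comp (f := fun a : Fin n → 𝕜 => (x₀, a)) a₀ hg'
      (hasFDerivAt_prodMk_right x₀ a₀)
    have h2 := (hasFDerivAt_pi'.1 h1 i).fderiv
    have h3 : fderiv 𝕜 (fun a => qGradient T x₀ a i) a₀ = _ := h2
    rw [h3]
    rfl
  have hBinj : ∀ a, B (0, a) = 0 → a = 0 := by
    intro a ha
    by_contra hne
    refine hdet (Matrix.exists_mulVec_eq_zero_iff.1 ⟨a, hne, ?_⟩)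
    rw [map_inr_eq_sum] at ha
    ext i
    have := congrFun ha i
    simp only [Finset.sum_apply, Pi.smul_apply, smul_eq_mul, hBa, Pi.zero_apply] at this
    simpa [Matrix.mulVec, dotProduct, mul_comm] using this
  obtain ⟨A, hA⟩ : ∃ A : ((Fin n → 𝕜) × (Fin n → 𝕜)) ≃L[𝕜] ((Fin n → 𝕜) × (Fin n → 𝕜)),
      (A : _ →L[𝕜] _) = (ContinuousLinearMap.fst 𝕜 _ _).prod B := by
    have hinj : Function.Injective ((ContinuousLinearMap.fst 𝕜 _ _).prod B).toLinearMap := by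
      rw [← LinearMap.ker_eq_bot, LinearMap.ker_eq_bot']
      rintro ⟨x, y⟩ hxy
      obtain ⟨rfl, h2⟩ : x = 0 ∧ B (x, y) = 0 := by simpa using hxy
      rw [hBinj y h2]
      rfl
    exact ⟨(LinearEquiv.ofInjectiveEndo _ hinj).toContinuousLinearEquiv, by ext <;> rfl⟩
  have hAd : HasFDerivAt G (A : _ →L[𝕜] _) (x₀, a₀) := hA ▸ hGd
  let e := hGs.toOpenPartialHomeomorph G hAd (by simp)
  have hes : (x₀, a₀) ∈ e.source := hGs.mem_toOpenPartialHomeomorph_source hAd (by simp)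
  have heG : ∀ z, e z = G z := fun z => rfl
  have htarget : c m₀ ∈ e.target := by
    rw [← hG₀]; exact e.map_source hes
  have hsymm₀ : e.symm (c m₀) = (x₀, a₀) := by
    rw [← hG₀]; exact e.left_inv hes
  have hsymmt : Filter.Tendsto e.symm (𝓝 (c m₀)) (𝓝 (x₀, a₀)) := by
    have := e.continuousAt_symm htarget
    rwa [ContinuousAt, hsymm₀] at this
  -- Write `p = (q, ∂S/∂q(q; α))` by the local inverse; the Hamilton–Jacobi equations identify `α`
  -- with the values of `H` at `p`.
  have hrel : ∀ᶠ p in 𝓝 (c m₀), p.2 = qGradient T p.1 (fun k => H k (c.symm p)) := by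
    filter_upwards [hsymmt.eventually hsol, e.open_target.mem_nhds htarget] with p hp hpt
    have h1 : G (e.symm p) = p := e.right_inv hpt
    have h2 : (e.symm p).1 = p.1 := (Prod.ext_iff.1 h1).1
    have h3 : qGradient T (e.symm p).1 (e.symm p).2 = p.2 := (Prod.ext_iff.1 h1).2
    have h4 : (fun k => H k (c.symm p)) = (e.symm p).2 := by
      funext k
      rw [← hp.2 k, h3, h2]
    rw [h4, ← h2, h3]
  have hΨ : Filter.Tendsto (fun p : (Fin n → 𝕜) × (Fin n → 𝕜) => (p.1, fun k => H k (c.symm p)))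
      (𝓝 (c m₀)) (𝓝 (x₀, a₀)) := by
    have : ContinuousAt (fun p : (Fin n → 𝕜) × (Fin n → 𝕜) => (p.1, fun k => H k (c.symm p)))
      (c m₀) := continuousAt_fst.prodMk hc
    rwa [ContinuousAt, hh₀] at this
  refine ⟨fun i z => z.2.1 - deriv (fun t => S i t z.2.2) z.1, fun i => ?_, fun i => ?_, ?_⟩
  · change ∀ᶠ z in 𝓝 (x₀ i, (c m₀).2 i, fun k => H k (c.symm (c m₀))), _
    rw [hh₀]
    -- Smoothness of `∂S_i/∂q_i` is read off from the gradient of the whole sum, with the other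
    -- coordinates frozen at `x₀`.
    let ι : 𝕜 × 𝕜 × (Fin n → 𝕜) → (Fin n → 𝕜) × (Fin n → 𝕜) := fun z =>
      (Function.update x₀ i z.1, z.2.2)
    have hι : ContDiff 𝕜 ∞ ι :=
      ((contDiff_update _ x₀ i).comp contDiff_fst).prodMk contDiff_snd.snd
    have hιt : Filter.Tendsto ι (𝓝 (x₀ i, (c m₀).2 i, a₀)) (𝓝 (x₀, a₀)) := by
      have := hι.continuous.tendsto (x₀ i, (c m₀).2 i, a₀)
      simpa only [ι, Function.update_eq_self] using this
    filter_upwards [hιt.eventually hgsm, (hιt.eventually hderiv).eventually_nhds] with z hz hz'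
    have h1 : ContDiffAt 𝕜 ∞ (fun z => z.2.1 - qGradient T (ι z).1 (ι z).2 i) z :=
      contDiffAt_snd.fst.sub ((contDiffAt_pi.1 hz i).comp z hι.contDiffAt)
    refine h1.congr_of_eventuallyEq (hz'.mono fun w hw => ?_)
    change _ = w.2.1 - qGradient T (ι w).1 (ι w).2 i
    rw [hw i]
    simp [ι]
  · filter_upwards [hrel, hΨ.eventually hderiv] with p hp hp'
    have := hp' i
    rw [← this, ← hp, sub_self]
  · change (Matrix.of fun i j => fderiv 𝕜 (fun a => (c m₀).2 i - deriv (fun t => S i t a) (x₀ i))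
      (fun k => H k (c.symm (c m₀))) (Pi.single j 1)).det ≠ 0
    rw [hh₀]
    have : ∀ i, fderiv 𝕜 (fun a => deriv (fun t => S i t a) (x₀ i)) a₀
        = fderiv 𝕜 (fun a => qGradient T x₀ a i) a₀ := fun i => Filter.EventuallyEq.fderiv_eq <|
      ((Continuous.prodMk_right x₀).continuousAt.eventually hderiv).mono fun a ha => (ha i).symm
    simp only [fderiv_const_sub, this]
    have hneg : (Matrix.of fun i j => (-fderiv 𝕜 (fun a => qGradient T x₀ a i) a₀)
        (Pi.single j 1)) = -(Matrix.of fun i j => fderiv 𝕜 (fun a => qGradient T x₀ a i) a₀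
        (Pi.single j 1)) := rfl
    rw [hneg, Matrix.det_neg]
    exact mul_ne_zero (pow_ne_zero _ (neg_ne_zero.2 one_ne_zero)) hdet

end HamiltonJacobi

/-! ### Linear algebra in a single tangent space. -/

section LinearAlgebra

variable {𝕜 : Type*} [RCLike 𝕜] {n : ℕ} {T : Type*} [AddCommGroup T] [Module 𝕜 T] [TopologicalSpace T]

/-- If independent covectors `a_1, …, a_n` are in involution, then the vectors `P a_i` span the
common kernel of the `a_i`. -/
theorem mem_span_iff_of_involution [FiniteDimensional 𝕜 T] (hT : Module.finrank 𝕜 T = 2 * n)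
    {P : (T →L[𝕜] 𝕜) →ₗ[𝕜] T} (hP : Function.Bijective P) {a : Fin n → T →L[𝕜] 𝕜}
    (ha : LinearIndependent 𝕜 a) (hinv : ∀ i j, a i (P (a j)) = 0) (v : T) :
    v ∈ Submodule.span 𝕜 (Set.range fun i => P (a i)) ↔ ∀ i, a i v = 0 := by
  have hcoe : LinearIndependent 𝕜 (fun i => (a i : Module.Dual 𝕜 T)) :=
    ha.map' (ContinuousLinearMap.coeLM 𝕜) (LinearMap.ker_eq_bot.2
      ContinuousLinearMap.coe_injective)
  have hmem : ∀ v, v ∈ (Submodule.span 𝕜 (Set.range fun i =>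
      (a i : Module.Dual 𝕜 T))).dualCoannihilator ↔ ∀ i, a i v = 0 := by
    intro v
    rw [Submodule.mem_dualCoannihilator]
    refine ⟨fun h i => h _ (Submodule.subset_span ⟨i, rfl⟩), fun h φ hφ => ?_⟩
    induction hφ using Submodule.span_induction with
    | mem x hx => obtain ⟨i, rfl⟩ := hx; exact h i
    | zero => rfl
    | add x y _ _ hx hy => rw [LinearMap.add_apply, hx, hy, add_zero]
    | smul c x _ hx => rw [LinearMap.smul_apply, hx, smul_zero]
  -- Involution gives one inclusion; equality follows because both spaces have dimension `n = 2n -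
  -- n`.
  have hle : Submodule.span 𝕜 (Set.range fun i => P (a i)) ≤ (Submodule.span 𝕜 (Set.range fun i =>
      (a i : Module.Dual 𝕜 T))).dualCoannihilator := by
    rw [Submodule.span_le]
    rintro _ ⟨j, rfl⟩
    exact (hmem _).2 fun i => hinv i j
  have h1 : Module.finrank 𝕜 (Submodule.span 𝕜 (Set.range fun i => P (a i))) = n := by
    have := finrank_span_eq_card (ha.map' P (LinearMap.ker_eq_bot.2 hP.1))
    rwa [Fintype.card_fin] at this
  have h2 := Subspace.finrank_add_finrank_dualCoannihilator_eq
    (Submodule.span 𝕜 (Set.range fun i => (a i : Module.Dual 𝕜 T)))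
  rw [finrank_span_eq_card hcoe, Fintype.card_fin, hT] at h2
  rw [Submodule.eq_of_le_of_finrank_eq hle (by omega), hmem]

variable {Θ : T ≃L[𝕜] ((Fin n → 𝕜) × (Fin n → 𝕜))} {P : (T →L[𝕜] 𝕜) →ₗ[𝕜] T} {N : T →ₗ[𝕜] T}
  {ξ η : Fin n → T →L[𝕜] 𝕜} {l : Fin n → 𝕜}

/-- The expansion of a covector in the dual basis `dx_k`, `dy_k`. -/
theorem covector_eq_sum (hξ : ∀ k v, ξ k v = (Θ v).1 k) (hη : ∀ k v, η k v = (Θ v).2 k)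
    (a : T →L[𝕜] 𝕜) : a = ∑ k, (a (Θ.symm (Pi.single k 1, 0)) • ξ k
      + a (Θ.symm (0, Pi.single k 1)) • η k) := by
  ext v
  have hv : v = ∑ k, ((Θ v).1 k • Θ.symm (Pi.single k 1, 0)
      + (Θ v).2 k • Θ.symm (0, Pi.single k 1)) := by
    apply Θ.injective
    simp only [map_sum, map_add, map_smul, Θ.apply_symm_apply]
    ext i <;> simp [Prod.fst_sum, Prod.snd_sum, Finset.sum_apply, Pi.single_apply]
  conv_lhs => rw [hv]
  simp only [map_sum, map_add, map_smul, smul_eq_mul, sum_apply, add_apply,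
    smul_apply, hξ, hη]
  exact Finset.sum_congr rfl fun k _ => by ring

theorem pow_apply_of_diagonal (hN : ∀ i v, ξ i (N v) = l i * ξ i v ∧ η i (N v) = l i * η i v)
    (r : ℕ) (i : Fin n) (v : T) :
    ξ i ((N ^ r) v) = l i ^ r * ξ i v ∧ η i ((N ^ r) v) = l i ^ r * η i v := by
  induction r generalizing i v with
  | zero => simp
  | succ r ih =>
    rw [pow_succ', Module.End.mul_apply, (hN _ _).1, (hN _ _).2, (ih _ _).1, (ih _ _).2]
    exact ⟨by ring, by ring⟩

/-- The brackets `⟨a, N^r P b⟩` in Darboux–Nijenhuis coordinates. -/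
theorem apply_pow_apply_eq_sum (hξ : ∀ k v, ξ k v = (Θ v).1 k) (hη : ∀ k v, η k v = (Θ v).2 k)
    (hanti : ∀ a b : T →L[𝕜] 𝕜, a (P b) = -b (P a))
    (hξη : ∀ i j, ξ i (P (η j)) = if i = j then 1 else 0) (hξξ : ∀ i j, ξ i (P (ξ j)) = 0)
    (hηη : ∀ i j, η i (P (η j)) = 0)
    (hN : ∀ i v, ξ i (N v) = l i * ξ i v ∧ η i (N v) = l i * η i v)
    (a b : T →L[𝕜] 𝕜) (r : ℕ) :
    a ((N ^ r) (P b)) = ∑ k, l k ^ r *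
      (a (Θ.symm (Pi.single k 1, 0)) * b (Θ.symm (0, Pi.single k 1))
        - a (Θ.symm (0, Pi.single k 1)) * b (Θ.symm (Pi.single k 1, 0))) := by
  -- This and the next formula are Hamilton's equations for the vector `P b`.
  have hxP : ∀ k, ξ k (P b) = b (Θ.symm (0, Pi.single k 1)) := by
    intro k
    conv_lhs => rw [covector_eq_sum hξ hη b]
    simp [map_sum, hξη, hξξ]
  have hyP : ∀ k, η k (P b) = -b (Θ.symm (Pi.single k 1, 0)) := by
    intro k
    have hηξ : ∀ i j, η i (P (ξ j)) = -if j = i then 1 else 0 := fun i j => by rw [hanti, hξη]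
    conv_lhs => rw [covector_eq_sum hξ hη b]
    simp [map_sum, hηξ, hηη]
  conv_lhs => rw [covector_eq_sum hξ hη a]
  simp only [sum_apply, add_apply, smul_apply, smul_eq_mul,
    (pow_apply_of_diagonal hN r _ _).1,
    (pow_apply_of_diagonal hN r _ _).2, hxP, hyP]
  exact Finset.sum_congr rfl fun k _ => by ring

/-- If the minimal polynomial of `N` has degree `n`, then its diagonal entries `λ_1, …, λ_n` in
Darboux–Nijenhuis coordinates are pairwise distinct. -/
theorem injective_of_natDegree_minpoly (hξ : ∀ k v, ξ k v = (Θ v).1 k)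
    (hη : ∀ k v, η k v = (Θ v).2 k)
    (hN : ∀ i v, ξ i (N v) = l i * ξ i v ∧ η i (N v) = l i * η i v)
    (hdeg : (minpoly 𝕜 N).natDegree = n) : Function.Injective l := by
  classical
  -- The product runs over distinct values and annihilates `N`, so its degree, the number of
  -- distinct `λ_i`, is at least `n`.
  let p : Polynomial 𝕜 := ∏ x ∈ Finset.univ.image l, (Polynomial.X - Polynomial.C x)
  have haeval : ∀ (q : Polynomial 𝕜) i v, ξ i (Polynomial.aeval N q v) = q.eval (l i) * ξ i v ∧
      η i (Polynomial.aeval N q v) = q.eval (l i) * η i v := by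
    intro q
    induction q using Polynomial.induction_on' with
    | add q₁ q₂ h₁ h₂ =>
      intro i v
      simp only [map_add, LinearMap.add_apply, (h₁ i v).1, (h₁ i v).2, (h₂ i v).1, (h₂ i v).2,
        Polynomial.eval_add, add_mul, and_self]
    | monomial r c =>
      intro i v
      simp [Polynomial.aeval_monomial, Module.algebraMap_end_apply,
        (pow_apply_of_diagonal hN r i v).1, (pow_apply_of_diagonal hN r i v).2, mul_assoc]
  have hroot : ∀ i, p.eval (l i) = 0 := fun i => by
    rw [Polynomial.eval_prod]
    exact Finset.prod_eq_zero (Finset.mem_image_of_mem l (Finset.mem_univ i)) (by simp)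
  have hzero : Polynomial.aeval N p = 0 := by
    ext v
    apply Θ.injective
    rw [LinearMap.zero_apply, map_zero]
    ext i
    · rw [← hξ, (haeval p i v).1, hroot, zero_mul]; rfl
    · rw [← hη, (haeval p i v).2, hroot, zero_mul]; rfl
  have hmonic : p.Monic := Polynomial.monic_prod_of_monic _ _ fun x _ => Polynomial.monic_X_sub_C x
  have hle : n ≤ (Finset.univ.image l).card := by
    refine hdeg.symm.trans_le ?_
    rw [← Polynomial.natDegree_finsetProd_X_sub_C_eq_card (R := 𝕜)]
    exact Polynomial.natDegree_le_of_dvd (minpoly.dvd 𝕜 N hzero) hmonic.ne_zero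
  have hcard : (Finset.univ.image l).card = (Finset.univ : Finset (Fin n)).card :=
    le_antisymm Finset.card_image_le (by simpa using hle)
  exact fun i j hij => Finset.card_image_iff.1 hcard (by simp) (by simp) hij

end LinearAlgebra

/-! ### Transfer to the manifold and proof of the equivalences. -/

section Manifold

variable {𝕜 : Type*} [RCLike 𝕜] {E : Type*} [NormedAddCommGroup E] [NormedSpace 𝕜 E]
  {M : Type*} [TopologicalSpace M] [ChartedSpace E M] {n : ℕ}

theorem RegularBihamiltonian.N_apply_P (B : RegularBihamiltonian 𝕜 E M n) (m : M)
    (a : TangentSpace 𝓘(𝕜, E) m →L[𝕜] 𝕜) : B.N m (B.P m a) = B.P' m a := by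
  change B.P' m ((LinearEquiv.ofBijective (B.P m) (B.invertible m)).symm (B.P m a)) = B.P' m a
  congr 1
  exact (LinearEquiv.ofBijective (B.P m) (B.invertible m)).symm_apply_apply a

/-- Since `N P = P'` on covectors, conditions (ii) and (iii) become the same statement. -/
theorem map_N_distribution (B : RegularBihamiltonian 𝕜 E M n) (H : Fin n → M → 𝕜) (m : M) :
    (distribution B.P H m).map (B.N m) = distribution B.P' H m := by
  rw [distribution, Submodule.map_span, ← Set.range_comp]
  congr 2
  funext i
  exact B.N_apply_P m _

/-- `D_H` is Lagrangian for `P`: isotropic by involution and of half the dimension. -/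
theorem IsIntegrableSystem.mem_distribution_iff [FiniteDimensional 𝕜 E]
    (hdim : Module.finrank 𝕜 E = 2 * n) {B : RegularBihamiltonian 𝕜 E M n} {H : Fin n → M → 𝕜}
    (hH : IsIntegrableSystem B H) (m : M) (v : TangentSpace 𝓘(𝕜, E) m) :
    v ∈ distribution B.P H m ↔ ∀ i, differential (H i) m v = 0 := by
  have : FiniteDimensional 𝕜 (TangentSpace 𝓘(𝕜, E) m) :=
    (inferInstance : FiniteDimensional 𝕜 E)
  have hT : Module.finrank 𝕜 (TangentSpace 𝓘(𝕜, E) m) = 2 * n := hdim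
  exact mem_span_iff_of_involution hT (B.invertible m)
    (hH.independent m) (fun i j => hH.involution i j m) v

/-- `D'_H ⊂ D_H` at `m` means that the `H_i` are in involution with respect to `P'` at `m`. -/
theorem IsIntegrableSystem.distribution_le_iff [FiniteDimensional 𝕜 E]
    (hdim : Module.finrank 𝕜 E = 2 * n) {B : RegularBihamiltonian 𝕜 E M n} {H : Fin n → M → 𝕜}
    (hH : IsIntegrableSystem B H) (m : M) :
    distribution B.P' H m ≤ distribution B.P H m ↔ ∀ i j, bracket B.P' (H i) (H j) m = 0 := by
  rw [distribution, Submodule.span_le, Set.range_subset_iff, forall_comm]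
  exact forall_congr' fun j => hH.mem_distribution_iff hdim m _

variable {c : OpenPartialHomeomorph M ((Fin n → 𝕜) × (Fin n → 𝕜))}
  {B : RegularBihamiltonian 𝕜 E M n} {H : Fin n → M → 𝕜}

theorem IsDarbouxNijenhuis.mdifferentiable (hc : IsDarbouxNijenhuis B c) :
    c.MDifferentiable 𝓘(𝕜, E) 𝓘(𝕜, (Fin n → 𝕜) × (Fin n → 𝕜)) :=
  ⟨hc.smooth.mdifferentiableOn (by simp), hc.smooth_symm.mdifferentiableOn (by simp)⟩

theorem IsDarbouxNijenhuis.contDiffAt (hc : IsDarbouxNijenhuis B c)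
    (hH : IsIntegrableSystem B H) {p : (Fin n → 𝕜) × (Fin n → 𝕜)} (hp : p ∈ c.target) :
    ContDiffAt 𝕜 ∞ (fun p k => H k (c.symm p)) p := by
  refine contDiffAt_pi.2 fun k => ?_
  have h1 : ContMDiffOn 𝓘(𝕜, (Fin n → 𝕜) × (Fin n → 𝕜)) 𝓘(𝕜, 𝕜) ∞ (H k ∘ c.symm) c.target :=
    (hH.smooth k).comp_contMDiffOn hc.smooth_symm
  exact (contMDiffOn_iff_contDiffOn.1 h1).contDiffAt (c.open_target.mem_nhds hp)

theorem IsDarbouxNijenhuis.differential_comp (hc : IsDarbouxNijenhuis B c) {m : M}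
    (hm : m ∈ c.source) {g : (Fin n → 𝕜) × (Fin n → 𝕜) → 𝕜} (hg : DifferentiableAt 𝕜 g (c m))
    (v : TangentSpace 𝓘(𝕜, E) m) :
    differential (fun m => g (c m)) m v =
      fderiv 𝕜 g (c m) (mfderiv 𝓘(𝕜, E) 𝓘(𝕜, (Fin n → 𝕜) × (Fin n → 𝕜)) c m v) := by
  have h1 := mfderiv_comp (I := 𝓘(𝕜, E)) (I'' := 𝓘(𝕜, 𝕜)) m hg.mdifferentiableAt
    (hc.mdifferentiable.mdifferentiableAt hm)
  have h2 : mfderiv 𝓘(𝕜, E) 𝓘(𝕜, 𝕜) (fun m => g (c m)) m = _ := h1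
  rw [differential, h2, mfderiv_eq_fderiv]
  rfl

theorem IsDarbouxNijenhuis.differential_apply (hc : IsDarbouxNijenhuis B c)
    (hH : IsIntegrableSystem B H) {m : M} (hm : m ∈ c.source) (i : Fin n)
    (v : TangentSpace 𝓘(𝕜, E) m) :
    differential (H i) m v = fderiv 𝕜 (fun p k => H k (c.symm p)) (c m)
      (mfderiv 𝓘(𝕜, E) 𝓘(𝕜, (Fin n → 𝕜) × (Fin n → 𝕜)) c m v) i := by
  have hd := (hc.contDiffAt hH (c.map_source hm)).differentiableAt (by simp)
  have h1 : (fun m => H i (c.symm (c m))) =ᶠ[𝓝 m] H i :=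
    Filter.eventuallyEq_of_mem (c.open_source.mem_nhds hm) fun m' hm' => by
      simp only [c.left_inv hm']
  have h2 : differential (E := E) (H i) m = differential (fun m => H i (c.symm (c m))) m :=
    (Filter.EventuallyEq.mfderiv_eq h1).symm
  rw [h2, hc.differential_comp hm (g := fun p => H i (c.symm p)) (differentiableAt_pi.1 hd i),
    (hasFDerivAt_pi'.1 hd.hasFDerivAt i).fderiv]
  rfl

/-- The brackets `⟨dH_i, N^r P dH_j⟩` in Darboux–Nijenhuis coordinates, and the pairwise
distinctness of the `λ_k` at regular points. -/
theorem IsDarbouxNijenhuis.exists_apply_pow_apply_eq_sum (hc : IsDarbouxNijenhuis B c)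
    (hH : IsIntegrableSystem B H) {m : M} (hm : m ∈ c.source) :
    ∃ l : Fin n → 𝕜, ((minpoly 𝕜 (B.N m)).natDegree = n → Function.Injective l) ∧
      ∀ (r : ℕ) (i j : Fin n),
        differential (H i) m ((B.N m ^ r) (B.P m (differential (H j) m))) = ∑ k, l k ^ r *
          (fderiv 𝕜 (fun p k => H k (c.symm p)) (c m) (Pi.single k 1, 0) i *
            fderiv 𝕜 (fun p k => H k (c.symm p)) (c m) (0, Pi.single k 1) j -
          fderiv 𝕜 (fun p k => H k (c.symm p)) (c m) (0, Pi.single k 1) i *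
            fderiv 𝕜 (fun p k => H k (c.symm p)) (c m) (Pi.single k 1, 0) j) := by
  obtain ⟨l, hl⟩ := hc.diagonal m hm
  let Θ : TangentSpace 𝓘(𝕜, E) m ≃L[𝕜] ((Fin n → 𝕜) × (Fin n → 𝕜)) := hc.mdifferentiable.mfderiv hm
  have hΘ : ∀ v, mfderiv 𝓘(𝕜, E) 𝓘(𝕜, (Fin n → 𝕜) × (Fin n → 𝕜)) c m v = Θ v := fun v => rfl
  have hξ : ∀ k v, differential (fun m => (c m).1 k) m v = (Θ v).1 k := by
    intro k v
    let L : ((Fin n → 𝕜) × (Fin n → 𝕜)) →L[𝕜] 𝕜 :=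
      (ContinuousLinearMap.proj k).comp (ContinuousLinearMap.fst 𝕜 (Fin n → 𝕜) (Fin n → 𝕜))
    have := hc.differential_comp hm (g := L) L.differentiableAt v
    rw [L.fderiv] at this
    exact this
  have hη : ∀ k v, differential (fun m => (c m).2 k) m v = (Θ v).2 k := by
    intro k v
    let L : ((Fin n → 𝕜) × (Fin n → 𝕜)) →L[𝕜] 𝕜 :=
      (ContinuousLinearMap.proj k).comp (ContinuousLinearMap.snd 𝕜 (Fin n → 𝕜) (Fin n → 𝕜))
    have := hc.differential_comp hm (g := L) L.differentiableAt v
    rw [L.fderiv] at this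
    exact this
  refine ⟨l, injective_of_natDegree_minpoly hξ hη hl, fun r i j => ?_⟩
  have key := apply_pow_apply_eq_sum hξ hη (B.poisson.antisymm m) (hc.bracket_xy m hm)
    (hc.bracket_xx m hm) (hc.bracket_yy m hm) hl (differential (H i) m) (differential (H j) m) r
  rw [key]
  simp only [hc.differential_apply hH hm, hΘ, Θ.apply_symm_apply]

/-- Benenti's condition implies the involutivity with respect to `P'`. -/
theorem IsDarbouxNijenhuis.bracket_eq_zero (hc : IsDarbouxNijenhuis B c)
    (hH : IsIntegrableSystem B H) {m : M} (hm : m ∈ c.source)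
    (hB : BenentiAt (fun p k => H k (c.symm p)) (c m)) (i j : Fin n) :
    bracket B.P' (H i) (H j) m = 0 := by
  obtain ⟨l, -, hl⟩ := hc.exists_apply_pow_apply_eq_sum hH hm
  -- The exponent `1` turns `N^r P` into `P'`.
  have := hl 1 i j
  rw [pow_one, B.N_apply_P] at this
  rw [bracket, this]
  exact Finset.sum_eq_zero fun k _ => by rw [hB k i j, sub_self, mul_zero]

/-- At regular points, the invariance of `D_H` under `N` implies Benenti's condition. -/
theorem IsDarbouxNijenhuis.benentiAt_of_regular [FiniteDimensional 𝕜 E]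
    (hdim : Module.finrank 𝕜 E = 2 * n) (hc : IsDarbouxNijenhuis B c)
    (hH : IsIntegrableSystem B H) {m : M} (hm : m ∈ c.source)
    (hreg : (minpoly 𝕜 (B.N m)).natDegree = n)
    (hle : (distribution B.P H m).map (B.N m) ≤ distribution B.P H m) :
    BenentiAt (fun p k => H k (c.symm p)) (c m) := by
  obtain ⟨l, hinj, hl⟩ := hc.exists_apply_pow_apply_eq_sum hH hm
  have hpow : ∀ (r : ℕ) (j : Fin n),
      (B.N m ^ r) (B.P m (differential (H j) m)) ∈ distribution B.P H m := by
    intro r j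
    induction r with
    | zero => exact Submodule.subset_span ⟨j, rfl⟩
    | succ r ih =>
      rw [pow_succ', Module.End.mul_apply]
      exact hle (Submodule.mem_map_of_mem ih)
  intro k i j
  -- Vandermonde: with distinct `λ_k`, the vanishing of `∑_k λ_k^r w_k` for all `r` forces every
  -- `w_k = 0`.
  have := Matrix.eq_zero_of_forall_pow_sum_mul_pow_eq_zero (hinj hreg) (v := fun k =>
    (fderiv 𝕜 (fun p k => H k (c.symm p)) (c m) (Pi.single k 1, 0) i *
      fderiv 𝕜 (fun p k => H k (c.symm p)) (c m) (0, Pi.single k 1) j -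
    fderiv 𝕜 (fun p k => H k (c.symm p)) (c m) (0, Pi.single k 1) i *
      fderiv 𝕜 (fun p k => H k (c.symm p)) (c m) (Pi.single k 1, 0) j)) fun r => by
    have h1 := hl r i j
    rw [(hH.mem_distribution_iff hdim m _).1 (hpow r j) i] at h1
    rw [h1]
    exact Finset.sum_congr rfl fun k _ => mul_comm _ _
  exact sub_eq_zero.1 (congrFun this k)

/-- The invariance of `D_H` under `N` on a Darboux–Nijenhuis chart implies Benenti's condition. -/
theorem IsDarbouxNijenhuis.benentiAt [FiniteDimensional 𝕜 E]
    (hdim : Module.finrank 𝕜 E = 2 * n) (hc : IsDarbouxNijenhuis B c)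
    (hH : IsIntegrableSystem B H)
    (hle : ∀ m ∈ c.source, (distribution B.P H m).map (B.N m) ≤ distribution B.P H m)
    {m : M} (hm : m ∈ c.source) :
    BenentiAt (fun p k => H k (c.symm p)) (c m) := by
  intro k i j
  have hD : ContinuousAt (fun m => fderiv 𝕜 (fun p k => H k (c.symm p)) (c m)) m :=
    ContinuousAt.comp (((hc.contDiffAt hH (c.map_source hm)).fderiv_right (m := 0)
      (by simp)).continuousAt) (c.continuousAt hm)
  have hDv : ∀ (v : (Fin n → 𝕜) × (Fin n → 𝕜)) (i : Fin n),
      ContinuousAt (fun m => fderiv 𝕜 (fun p k => H k (c.symm p)) (c m) v i) m := fun v i =>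
    continuousAt_pi.1 (hD.clm_apply continuousAt_const) i
  -- If this partial bracket were nonzero at `m`, it would be nonzero near `m`, hence at some
  -- regular point of the chart.
  have hw := ((hDv (Pi.single k 1, 0) i).mul (hDv (0, Pi.single k 1) j)).sub
    ((hDv (0, Pi.single k 1) i).mul (hDv (Pi.single k 1, 0) j))
  rw [← sub_eq_zero]
  by_contra hne
  obtain ⟨m', ⟨hm'1, hm'2⟩, hm'3⟩ := mem_closure_iff_nhds.1 (B.regular m) _
    (Filter.inter_mem (hw.eventually_ne hne) (c.open_source.mem_nhds hm))
  exact hm'1 (sub_eq_zero.2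
    (hc.benentiAt_of_regular hdim hH hm'2 hm'3.1 (hle m' hm'2) k i j))

theorem isSeparable_iff_hasSeparationRelationsAt
    (c : OpenPartialHomeomorph M ((Fin n → 𝕜) × (Fin n → 𝕜))) (H : Fin n → M → 𝕜) :
    IsSeparable c H ↔
      ∀ m ∈ c.source, HasSeparationRelationsAt (fun p k => H k (c.symm p)) (c m) := by
  refine forall₂_congr fun m hm => ?_
  have h0 : (fun k => H k (c.symm (c m))) = fun k => H k m := by rw [c.left_inv hm]
  simp only [HasSeparationRelationsAt, h0]
  refine exists_congr fun Φ => and_congr_right fun _ => and_congr_left fun _ =>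
    forall_congr' fun i => ⟨fun h => ?_, fun h => ?_⟩
  · have ht : Filter.Tendsto c.symm (𝓝 (c m)) (𝓝 m) := c.tendsto_symm hm
    filter_upwards [ht.eventually h, c.open_target.mem_nhds (c.map_source hm)] with p hp hpt
    rwa [c.right_inv hpt] at hp
  · filter_upwards [(c.continuousAt hm).eventually h, c.open_source.mem_nhds hm] with m' hm' hs
    rwa [c.left_inv hs] at hm'

theorem IsDarbouxNijenhuis.independent (hc : IsDarbouxNijenhuis B c)
    (hH : IsIntegrableSystem B H) {m : M} (hm : m ∈ c.source) (a : Fin n → 𝕜)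
    (ha : ∀ v, ∑ i, a i * fderiv 𝕜 (fun p k => H k (c.symm p)) (c m) v i = 0) : a = 0 := by
  have h1 : ∑ i, a i • (differential (H i) m : TangentSpace 𝓘(𝕜, E) m →L[𝕜] 𝕜) = 0 := by
    ext v
    simp only [sum_apply, smul_apply, smul_eq_mul, hc.differential_apply hH hm]
    exact ha _
  exact funext (Fintype.linearIndependent_iff.1 (hH.independent m) a h1)

theorem IsDarbouxNijenhuis.eventually_contDiffAt (hc : IsDarbouxNijenhuis B c)
    (hH : IsIntegrableSystem B H) {m : M} (hm : m ∈ c.source) :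
    ∀ᶠ p in 𝓝 (c m), ContDiffAt 𝕜 ∞ (fun p k => H k (c.symm p)) p :=
  Filter.eventually_of_mem (c.open_target.mem_nhds (c.map_source hm)) fun _ hp => hc.contDiffAt hH hp

theorem IsDarbouxNijenhuis.eventually_benentiAt [FiniteDimensional 𝕜 E]
    (hdim : Module.finrank 𝕜 E = 2 * n) (hc : IsDarbouxNijenhuis B c)
    (hH : IsIntegrableSystem B H)
    (hle : ∀ m ∈ c.source, distribution B.P' H m ≤ distribution B.P H m)
    {m : M} (hm : m ∈ c.source) :
    ∀ᶠ p in 𝓝 (c m), BenentiAt (fun p k => H k (c.symm p)) p := by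
  filter_upwards [c.open_target.mem_nhds (c.map_source hm)] with p hp
  have := hc.benentiAt hdim hH (fun m hm => (map_N_distribution B H m).trans_le (hle m hm))
    (c.map_target hp)
  rwa [c.right_inv hp] at this

/-- From relations to inclusion the argument is pointwise; the converse uses Benenti's condition on
a neighbourhood, since it solves equations there. -/
theorem IsDarbouxNijenhuis.isSeparable_iff_distribution_le [FiniteDimensional 𝕜 E]
    (hdim : Module.finrank 𝕜 E = 2 * n) (hc : IsDarbouxNijenhuis B c)
    (hH : IsIntegrableSystem B H) : IsSeparable c H ↔
      ∀ m ∈ c.source, distribution B.P' H m ≤ distribution B.P H m := by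
  rw [isSeparable_iff_hasSeparationRelationsAt]
  refine ⟨fun h m hm => (hH.distribution_le_iff hdim m).2 ?_, fun h m hm => ?_⟩
  · exact hc.bracket_eq_zero hH hm
      ((h m hm).benentiAt ((hc.contDiffAt hH (c.map_source hm)).differentiableAt (by simp)))
  · exact BenentiAt.hasSeparationRelationsAt (hc.eventually_contDiffAt hH hm)
      (hc.eventually_benentiAt hdim hH h hm) (hc.independent hH hm)

theorem IsDarbouxNijenhuis.eq_zero_of_momentumNondegenerate (hc : IsDarbouxNijenhuis B c)
    (hH : IsIntegrableSystem B H) (hnd : MomentumNondegenerate c H) {m : M} (hm : m ∈ c.source)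
    (y : Fin n → 𝕜) (hy : fderiv 𝕜 (fun p k => H k (c.symm p)) (c m) (0, y) = 0) : y = 0 := by
  by_contra hne
  refine hnd m hm (Matrix.exists_mulVec_eq_zero_iff.1 ⟨y, hne, ?_⟩)
  have hd := ((hc.contDiffAt hH (c.map_source hm)).differentiableAt (by simp)).hasFDerivAt
  have hentry : ∀ i, fderiv 𝕜 (fun p => H i (c.symm ((c m).1, p))) (c m).2 =
      (ContinuousLinearMap.proj i).comp ((fderiv 𝕜 (fun p k => H k (c.symm p)) (c m)).comp
        (ContinuousLinearMap.inr 𝕜 (Fin n → 𝕜) (Fin n → 𝕜))) := fun i =>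
    (HasFDerivAt.comp (f := fun p : Fin n → 𝕜 => ((c m).1, p)) (c m).2 (hasFDerivAt_pi'.1 hd i)
      (hasFDerivAt_prodMk_right (c m).1 (c m).2)).fderiv
  rw [map_inr_eq_sum] at hy
  ext i
  have := congrFun hy i
  simp only [Finset.sum_apply, Pi.smul_apply, smul_eq_mul, Pi.zero_apply] at this
  simpa [Matrix.mulVec, dotProduct, mul_comm, hentry] using this

/-- A complete integral yields separation relations, which give the inclusion. Conversely,
non-degeneracy in the momenta allows every relation to be solved for `y_k` and integrated in `x_k`.
-/
theorem IsDarbouxNijenhuis.hamiltonJacobiSeparable_iff [FiniteDimensional 𝕜 E]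
    (hdim : Module.finrank 𝕜 E = 2 * n) (hc : IsDarbouxNijenhuis B c)
    (hH : IsIntegrableSystem B H) (hnd : MomentumNondegenerate c H) :
    HamiltonJacobiSeparable c H ↔
      ∀ m ∈ c.source, distribution B.P' H m ≤ distribution B.P H m := by
  refine ⟨fun h => ?_, fun h m hm => ?_⟩
  · rw [← hc.isSeparable_iff_distribution_le hdim hH, isSeparable_iff_hasSeparationRelationsAt]
    intro m hm
    obtain ⟨S, hS⟩ := h m hm
    exact hS.hasSeparationRelationsAt hm (hc.contDiffAt hH (c.map_source hm)).continuousAt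
  · exact BenentiAt.exists_isCompleteIntegralAt hm (hc.eventually_contDiffAt hH hm)
      (hc.eventually_benentiAt hdim hH h hm) (hc.eq_zero_of_momentumNondegenerate hH hnd hm)

/-- The inclusion amounts to the vanishing of the brackets of the `H_i` under `P'`, which are
continuous functions. -/
theorem IsIntegrableSystem.distribution_le_of_dense [FiniteDimensional 𝕜 E]
    (hdim : Module.finrank 𝕜 E = 2 * n) (hH : IsIntegrableSystem B H) {s : Set M} (hs : Dense s)
    (hle : ∀ m ∈ s, distribution B.P' H m ≤ distribution B.P H m) (m : M) :
    distribution B.P' H m ≤ distribution B.P H m := by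
  refine (hH.distribution_le_iff hdim m).2 fun i j => ?_
  have hcont : Continuous (bracket B.P' (H i) (H j)) :=
    (contMDiffOn_univ.1 (B.poisson'.smooth Set.univ isOpen_univ _ _ (hH.smooth i).contMDiffOn
      (hH.smooth j).contMDiffOn)).continuous
  exact congrFun (hcont.ext_on hs continuous_const
    fun m hm => (hH.distribution_le_iff hdim m).1 (hle m hm) i j) m

end Manifold

end Bihamiltonian

open Bihamiltonian in
theorem theorem3p1 {𝕜 : Type*} [RCLike 𝕜] {n : ℕ}
    {E : Type*} [NormedAddCommGroup E] [NormedSpace 𝕜 E] [FiniteDimensional 𝕜 E]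
    (hdim : Module.finrank 𝕜 E = 2 * n)
    {M : Type*} [TopologicalSpace M] [ChartedSpace E M] [IsManifold 𝓘(𝕜, E) ∞ M]
    (B : RegularBihamiltonian 𝕜 E M n) (H : Fin n → M → 𝕜) (hH : IsIntegrableSystem B H) :
    (∀ c : OpenPartialHomeomorph M ((Fin n → 𝕜) × (Fin n → 𝕜)), IsDarbouxNijenhuis B c →
      List.TFAE [
        IsSeparable c H,
        ∀ m ∈ c.source, distribution B.P' H m ≤ distribution B.P H m,
        ∀ m ∈ c.source, (distribution B.P H m).map (B.N m) ≤ distribution B.P H m] ∧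
      (MomentumNondegenerate c H →
        (HamiltonJacobiSeparable c H ↔
          ∀ m ∈ c.source, distribution B.P' H m ≤ distribution B.P H m))) ∧
    (∀ A : Set (OpenPartialHomeomorph M ((Fin n → 𝕜) × (Fin n → 𝕜))),
      (∀ c ∈ A, IsDarbouxNijenhuis B c) → Dense (⋃ c ∈ A, c.source) →
      List.TFAE [
        ∀ c ∈ A, IsSeparable c H,
        ∀ m, distribution B.P' H m ≤ distribution B.P H m,
        ∀ m, (distribution B.P H m).map (B.N m) ≤ distribution B.P H m]) := by
  refine ⟨fun c hc => ⟨?_, hc.hamiltonJacobiSeparable_iff hdim hH⟩, fun A hA hdense => ?_⟩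
  · simp only [map_N_distribution]
    tfae_have 1 ↔ 2 := hc.isSeparable_iff_distribution_le hdim hH
    tfae_have 2 ↔ 3 := Iff.rfl
    tfae_finish
  · simp only [map_N_distribution]
    tfae_have 1 ↔ 2 := by
      refine ⟨fun h => hH.distribution_le_of_dense hdim hdense fun m hm => ?_, fun h c hc =>
        ((hA c hc).isSeparable_iff_distribution_le hdim hH).2 fun m _ => h m⟩
      obtain ⟨c, hcA, hm⟩ := Set.mem_iUnion₂.1 hm
      exact ((hA c hcA).isSeparable_iff_distribution_le hdim hH).1 (h c hcA) m hm
    tfae_have 2 ↔ 3 := Iff.rfl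
    tfae_finish
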